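/- Let $n\ge 0$, let $\mathbb T^n=(\mathbb R/\mathbb Z)^n$ carry normalized Haar measure and $\mathbb Z^n$ counting measure. For $m\in\mathbb Z^n$, $w\in\mathbb T^n$ put $M_wT_mg(k)=e^{2\pi i w\cdot k}g(k-m)$ and $V_gf(m,w)=\sum_{k\in\mathbb Z^n}f(k)\overline{M_wT_mg(k)}$. For a non-zero window $\varphi\in\mathcal S(\mathbb Z^n)$, $M^p(\mathbb Z^n)$ is the space of tempered distributions (sequences of at most polynomial growth) $f$ on $\mathbb Z^n$ with $\|f\|_{M^p(\mathbb Z^n)}=\|V_\varphi f\|_{L^p(\mathbb Z^n\times\mathbb T^n)}<\infty$. Likewise, for a non-zero window $\Phi\in\mathcal S(\mathbb Z^n\times\mathbb T^n)$, $M^p(\mathbb Z^n\times\mathbb T^n)$ is the space of $\sigma\in\mathcal S'(\mathbb Z^n\times\mathbb T^n)$ with $$\|\sigma\|_{M^p(\mathbb Z^n\times\mathbb T^n)}=\|V_\Phi\sigma\|_{L^p((\mathbb Z^n\times\mathbb T^n)\times(\mathbb T^n\times\mathbb Z^n))}<\infty,\qquad V_\Phi\sigma(z,\xi)=\langle\sigma,M_\xi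 T_z\Phi\rangle ,$$ where $T_{(m,w)}\Phi(k,y)=\Phi(k-m,y-w)$ and $M_{(x,\zeta)}\Psi(k,y)=e^{2\pi i(k\cdot x+\zeta\cdot y)}\Psi(k,y)$. For $\sigma\in L^1(\mathbb Z^n\times\mathbb T^n)\cup L^\infty(\mathbb Z^n\times\mathbb T^n)$ and $f\in\ell^2(\mathbb Z^n)$ the localization operator is $$L_\sigma^{g_1,g_2}f(k)=\sum_{m\in\mathbb Z^n}\int_{\mathbb T^n}\sigma(m,w)\,V_{g_1}f(m,w)\,M_wT_mg_2(k)\,dw,\qquad k\in\mathbb Z^n .$$ **Theorem.** For all non-zero windows $\varphi\in\mathcal S(\mathbb Z^n)$, $\Phi\in\mathcal S(\mathbb Z^n\times\mathbb T^n)$ there is a constant $C>0$, depending only on $n,\varphi,\Phi$, such that for all $1<p<\infty$ and all $g_1,g_2\in M^1(\mathbb Z^n)$ the following holds. There is a linear map $\sigma\mapsto L_\sigma^{g_1,g_2}$ from $M^p(\mathbb Z^n\times\mathbb T^n)$ to $\mathcal B(\ell^2(\mathbb Z^n))$ which is given by the formula above for every $\sigma\in M^p(\mathbb Z^n\times\mathbb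 T^n)$ that is a function in $L^1\cup L^\infty$, and which satisfies $$\|L_\sigma^{g_1,g_2}\|_{\mathcal B(\ell^2(\mathbb Z^n))}\le C\,\|\sigma\|_{M^p(\mathbb Z^n\times\mathbb T^n)}\,\|g_1\|_{M^1(\mathbb Z^n)}\,\|g_2\|_{M^1(\mathbb Z^n)}\qquad\text{for all }\sigma\in M^p(\mathbb Z^n\times\mathbb T^n).$$ It is the only bounded linear map from $M^p(\mathbb Z^n\times\mathbb T^n)$ to $\mathcal B(\ell^2(\mathbb Z^n))$ that is given by the formula for those $\sigma\in M^p\cap M^1\cap M^\infty$ that are functions in $L^1\cup L^\infty$. Moreover, there are windows with $\|\varphi\|_{\ell^2(\mathbb Z^n)}=1$, $\|\Phi\|_{L^2(\mathbb Z^n\times\mathbb T^n)}=1$ and $\|\Phi\|_{L^1(\mathbb Z^n\times\mathbb T^n)}\le1$ for which all this holds with $C=1$, that is, $$\|L_\sigma^{g_1,g_2}\|_{\mathcal B(\ell^2(\mathbb Z^n))}\le\|\sigma\|_{M^p(\mathbb Z^n\times\mathbb T^n)}\,\|g_1\|_{M^1(\mathbb Z^n)}\,\|g_2\|_{M^1(\mathbb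 Z^n)}.$$ -/

import Mathlib

open MeasureTheory
open scoped ENNReal ContDiff ComplexConjugate

noncomputable section

namespace LocOp

/-- The lattice `ℤⁿ`. -/
abbrev Zn (n : ℕ) := Fin n → ℤ

/-- The torus `𝕋ⁿ = (ℝ/ℤ)ⁿ`; its characters are `UnitAddTorus.mFourier k w = e^{2πi k·w}`. -/
abbrev Tn (n : ℕ) := UnitAddTorus (Fin n)

/-- Normalized Haar measure on `𝕋ⁿ`. -/
def torusMeasure (n : ℕ) : Measure (Tn n) :=
  Measure.pi fun _ => AddCircle.haarAddCircle

/-- Counting measure times Haar measure on `ℤⁿ × 𝕋ⁿ`. -/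
def phaseMeasure (n : ℕ) : Measure (Zn n × Tn n) :=
  (Measure.count : Measure (Zn n)).prod (torusMeasure n)

/-- The measure on `(ℤⁿ × 𝕋ⁿ) × (𝕋ⁿ × ℤⁿ)`, where `𝕋ⁿ × ℤⁿ` is the dual group of `ℤⁿ × 𝕋ⁿ`. -/
def doublePhaseMeasure (n : ℕ) : Measure ((Zn n × Tn n) × (Tn n × Zn n)) :=
  (phaseMeasure n).prod ((torusMeasure n).prod (Measure.count : Measure (Zn n)))

/-! Time-frequency analysis on `ℤⁿ`. -/

/-- The Schwartz space `𝓢(ℤⁿ)` of rapidly decreasing functions. -/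
def IsSchwartz {n : ℕ} (φ : Zn n → ℂ) : Prop :=
  ∀ M : ℕ, ∃ C : ℝ, ∀ k, (1 + ‖k‖) ^ M * ‖φ k‖ ≤ C

/-- Tempered distributions on `ℤⁿ`, identified as usual with the functions of at most polynomial
growth. -/
def IsTempered {n : ℕ} (f : Zn n → ℂ) : Prop :=
  ∃ M : ℕ, ∃ C : ℝ, ∀ k, ‖f k‖ ≤ C * (1 + ‖k‖) ^ M

/-- `M_w T_m g`, for `z = (m, w)`. -/
def tfShift {n : ℕ} (z : Zn n × Tn n) (g : Zn n → ℂ) (k : Zn n) : ℂ :=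
  UnitAddTorus.mFourier k z.2 * g (k - z.1)

/-- The short-time Fourier transform `V_g f (m, w) = ∑ₖ f(k) conj (M_w T_m g (k))`. -/
def stft {n : ℕ} (g f : Zn n → ℂ) (z : Zn n × Tn n) : ℂ :=
  ∑' k, f k * conj (tfShift z g k)

/-- Membership in the modulation space `M^p(ℤⁿ)` (with window `φ`). -/
def MemMod {n : ℕ} (φ : Zn n → ℂ) (p : ℝ≥0∞) (f : Zn n → ℂ) : Prop :=
  IsTempered f ∧ MemLp (stft φ f) p (phaseMeasure n)

/-- The norm of `M^p(ℤⁿ)` (with window `φ`). -/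
def modNorm {n : ℕ} (φ : Zn n → ℂ) (p : ℝ≥0∞) (f : Zn n → ℂ) : ℝ :=
  (eLpNorm (stft φ f) p (phaseMeasure n)).toReal

/-! Time-frequency analysis on `ℤⁿ × 𝕋ⁿ`. -/

/-- The `ℤⁿ`-periodic lift to `ℝⁿ` of a function on `𝕋ⁿ`. -/
def lift {n : ℕ} (u : Tn n → ℂ) (x : Fin n → ℝ) : ℂ :=
  u fun i => (x i : UnitAddCircle)

/-- `Φ(k, ·)` is smooth on the torus for every `k`, and each of its derivatives decreases rapidly
in `k`, uniformly on the torus. -/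
def IsSchwartzZT {n : ℕ} (Φ : Zn n × Tn n → ℂ) : Prop :=
  (∀ k, ContDiff ℝ ∞ (lift fun y => Φ (k, y))) ∧
    ∀ M i : ℕ, ∃ C : ℝ, ∀ k x,
      (1 + ‖k‖) ^ M * ‖iteratedFDeriv ℝ i (lift fun y => Φ (k, y)) x‖ ≤ C

/-- The Schwartz space `𝓢(ℤⁿ × 𝕋ⁿ)`. -/
def schwartzZT (n : ℕ) : Submodule ℂ (Zn n × Tn n → ℂ) where
  carrier := {Φ | IsSchwartzZT Φ}
  zero_mem' := by
    have h0 : (lift fun _ => (0 : ℂ) : (Fin n → ℝ) → ℂ) = fun _ => 0 := rfl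
    refine ⟨fun k => ?_, fun M i => ⟨0, fun k x => ?_⟩⟩
    · simp only [Pi.zero_apply, h0]; exact contDiff_const
    · simp only [Pi.zero_apply, h0]
      rw [show (fun _ : Fin n → ℝ => (0 : ℂ)) = 0 from rfl, iteratedFDeriv_zero]
      simp
  add_mem' := by
    rintro Φ Ψ ⟨h1, h2⟩ ⟨h3, h4⟩
    have e : ∀ k, (lift fun y => (Φ + Ψ) (k, y)) =
        (lift fun y => Φ (k, y)) + (lift fun y => Ψ (k, y)) := fun k => rfl
    refine ⟨fun k => ?_, fun M i => ?_⟩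
    · rw [e]; exact (h1 k).add (h3 k)
    · obtain ⟨C, hC⟩ := h2 M i
      obtain ⟨D, hD⟩ := h4 M i
      refine ⟨C + D, fun k x => ?_⟩
      rw [e, iteratedFDeriv_add_apply ((h1 k).of_le (by exact_mod_cast le_top)).contDiffAt
        ((h3 k).of_le (by exact_mod_cast le_top)).contDiffAt]
      refine le_trans ?_ (add_le_add (hC k x) (hD k x))
      rw [← mul_add]
      exact mul_le_mul_of_nonneg_left (norm_add_le _ _) (by positivity)
  smul_mem' := by
    rintro c Φ ⟨h1, h2⟩
    have e : ∀ k, (lift fun y => (c • Φ) (k, y)) = c • (lift fun y => Φ (k, y)) := fun k => rfl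
    refine ⟨fun k => ?_, fun M i => ?_⟩
    · rw [e]; exact (h1 k).const_smul c
    · obtain ⟨C, hC⟩ := h2 M i
      refine ⟨‖c‖ * C, fun k x => ?_⟩
      rw [e, iteratedFDeriv_const_smul_apply
        ((h1 k).of_le (by exact_mod_cast le_top)).contDiffAt, norm_smul, mul_left_comm]
      exact mul_le_mul_of_nonneg_left (hC k x) (norm_nonneg _)

/-- The tempered distributions `𝓢'(ℤⁿ × 𝕋ⁿ)`: the linear functionals on `𝓢(ℤⁿ × 𝕋ⁿ)` that are
bounded by a multiple of finitely many of the seminorms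
`sup_{k,x} (1 + |k|)^N |D^i Φ(k, x)|`. -/
def temperedZT (n : ℕ) : Submodule ℂ (schwartzZT n →ₗ[ℂ] ℂ) where
  carrier := {u | ∃ N : ℕ, ∃ C : ℝ, 0 ≤ C ∧ ∀ (Φ : schwartzZT n) (B : ℝ),
    (∀ i ≤ N, ∀ k x,
      (1 + ‖k‖) ^ N * ‖iteratedFDeriv ℝ i (lift fun y => Φ.1 (k, y)) x‖ ≤ B) → ‖u Φ‖ ≤ C * B}
  zero_mem' := by
    refine ⟨0, 0, le_rfl, fun Φ B _ => by simp⟩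
  add_mem' := by
    rintro u v ⟨N, C, hC, hu⟩ ⟨N', C', hC', hv⟩
    refine ⟨max N N', C + C', by positivity, fun Φ B hB => ?_⟩
    have mono : ∀ L ≤ max N N', ∀ i ≤ L, ∀ k x,
        (1 + ‖k‖) ^ L * ‖iteratedFDeriv ℝ i (lift fun y => Φ.1 (k, y)) x‖ ≤ B := by
      intro L hL i hi k x
      refine le_trans ?_ (hB i (hi.trans hL) k x)
      exact mul_le_mul_of_nonneg_right
        (pow_le_pow_right₀ (by linarith [norm_nonneg k]) hL) (norm_nonneg _)
    calc ‖(u + v) Φ‖ ≤ ‖u Φ‖ + ‖v Φ‖ := norm_add_le _ _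
      _ ≤ C * B + C' * B := add_le_add (hu Φ B (mono N (le_max_left _ _)))
          (hv Φ B (mono N' (le_max_right _ _)))
      _ = (C + C') * B := by ring
  smul_mem' := by
    rintro c u ⟨N, C, hC, hu⟩
    refine ⟨N, ‖c‖ * C, by positivity, fun Φ B hB => ?_⟩
    rw [LinearMap.smul_apply, norm_smul, mul_assoc]
    exact mul_le_mul_of_nonneg_left (hu Φ B hB) (norm_nonneg _)

/-- `M_ξ T_z Φ (k, y) = e^{2πi (k·x + ζ·y)} Φ(k - m, y - w)`, for `z = (m, w)` in `ℤⁿ × 𝕋ⁿ` and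
`ξ = (x, ζ)` in the dual group `𝕋ⁿ × ℤⁿ`. -/
def tfShiftZT {n : ℕ} (z : Zn n × Tn n) (ξ : Tn n × Zn n) (Φ : Zn n × Tn n → ℂ)
    (q : Zn n × Tn n) : ℂ :=
  UnitAddTorus.mFourier q.1 ξ.1 * UnitAddTorus.mFourier ξ.2 q.2 * Φ (q - z)

theorem iteratedDeriv_exp_char (c : ℂ) (i : ℕ) :
    iteratedDeriv i (fun t : ℝ => Complex.exp (c * t)) = fun t : ℝ => c ^ i * Complex.exp (c * t) := by
  induction i with
  | zero => simp
  | succ i ih =>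
    rw [iteratedDeriv_succ, ih]
    funext t
    have h : HasDerivAt (fun t : ℝ => Complex.exp (c * t)) (Complex.exp (c * t) * (c * 1)) t :=
      ((Complex.ofRealCLM.hasDerivAt (x := t)).const_mul c).cexp
    rw [(h.const_mul (c ^ i)).deriv]
    ring

/-- The linear form `x ↦ ζ·x`. -/
def dotForm {n : ℕ} (ζ : Zn n) : (Fin n → ℝ) →L[ℝ] ℝ :=
  ∑ i, (ζ i : ℝ) • ContinuousLinearMap.proj i

theorem lift_mFourier {n : ℕ} (ζ : Zn n) :
    lift (fun y => UnitAddTorus.mFourier ζ y) =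
      (fun t : ℝ => Complex.exp ((2 * Real.pi * Complex.I) * t)) ∘ dotForm ζ := by
  funext x
  have hd : dotForm ζ x = ∑ i, (ζ i : ℝ) * x i := by simp [dotForm]
  simp only [lift, UnitAddTorus.mFourier, ContinuousMap.coe_mk, fourier_coe_apply, Function.comp,
    hd]
  rw [← Complex.exp_sum]
  congr 1
  push_cast
  rw [Finset.mul_sum]
  refine Finset.sum_congr rfl fun i _ => ?_
  simp
  ring

theorem contDiff_exp_char (c : ℂ) : ContDiff ℝ ∞ (fun t : ℝ => Complex.exp (c * t)) :=
  (contDiff_const.mul Complex.ofRealCLM.contDiff).cexp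

theorem contDiff_lift_mFourier {n : ℕ} (ζ : Zn n) :
    ContDiff ℝ ∞ (lift (fun y => UnitAddTorus.mFourier ζ y)) := by
  rw [lift_mFourier]
  exact (contDiff_exp_char _).comp (ContinuousLinearMap.contDiff _)

theorem bound_lift_mFourier {n : ℕ} (ζ : Zn n) (i : ℕ) : ∃ C : ℝ, 0 ≤ C ∧ ∀ x,
    ‖iteratedFDeriv ℝ i (lift (fun y => UnitAddTorus.mFourier ζ y)) x‖ ≤ C := by
  rw [lift_mFourier]
  refine ⟨‖(2 * Real.pi * Complex.I : ℂ)‖ ^ i * ∏ _j : Fin i, ‖dotForm ζ‖, by positivity, fun x => ?_⟩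
  rw [(dotForm ζ).iteratedFDeriv_comp_right (contDiff_exp_char _) x (i := i) (by exact_mod_cast le_top)]
  refine (ContinuousMultilinearMap.norm_compContinuousLinearMap_le _ _).trans ?_
  refine mul_le_mul_of_nonneg_right ?_ (by positivity)
  rw [norm_iteratedFDeriv_eq_norm_iteratedDeriv, iteratedDeriv_exp_char, norm_mul, norm_pow,
    Complex.norm_exp]
  simp

theorem IsSchwartzZT.tfShift {n : ℕ} {Φ : Zn n × Tn n → ℂ} (h : IsSchwartzZT Φ)
    (z : Zn n × Tn n) (ξ : Tn n × Zn n) : IsSchwartzZT (tfShiftZT z ξ Φ) := by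
  obtain ⟨h1, h2⟩ := h
  obtain ⟨m, w⟩ := z
  obtain ⟨b, hb⟩ : ∃ b : Fin n → ℝ, ∀ i, (b i : UnitAddCircle) = w i :=
    Classical.skolem.1 fun i => QuotientAddGroup.mk_surjective (w i)
  have e : ∀ k, (lift fun y => tfShiftZT (m, w) ξ Φ (k, y)) =
      UnitAddTorus.mFourier k ξ.1 • fun x => lift (fun y => UnitAddTorus.mFourier ξ.2 y) x *
        (fun x => lift (fun y => Φ (k - m, y)) (x - b)) x := by
    intro k
    funext x
    have hx : (fun i => ((x - b) i : UnitAddCircle)) =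
        (fun i => (x i : UnitAddCircle)) - w := by
      funext i
      simp [← hb i]
    simp only [lift, tfShiftZT, Pi.smul_apply, smul_eq_mul, Prod.mk_sub_mk, hx, mul_assoc]
  have hs : ∀ k, ContDiff ℝ ∞ (fun x => lift (fun y => Φ (k - m, y)) (x - b)) := fun k =>
    (h1 (k - m)).comp (contDiff_id.sub contDiff_const)
  have hm := contDiff_lift_mFourier ξ.2
  refine ⟨fun k => ?_, fun M i => ?_⟩
  · rw [e]
    exact (show ContDiff ℝ ∞ (fun x => lift (fun y => UnitAddTorus.mFourier ξ.2 y) x *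
      (fun x => lift (fun y => Φ (k - m, y)) (x - b)) x) from hm.mul (hs k)).const_smul
        (UnitAddTorus.mFourier k ξ.1)
  · choose A hA0 hA using bound_lift_mFourier ξ.2
    choose D hD using h2 M
    refine ⟨∑ j ∈ Finset.range (i + 1), (i.choose j : ℝ) * A j * ((1 + ‖m‖) ^ M * D (i - j)),
      fun k x => ?_⟩
    have hn : ‖UnitAddTorus.mFourier k ξ.1‖ ≤ 1 :=
      ((UnitAddTorus.mFourier k).norm_coe_le_norm ξ.1).trans_eq UnitAddTorus.mFourier_norm
    have hp : ContDiff ℝ ∞ (fun x => lift (fun y => UnitAddTorus.mFourier ξ.2 y) x *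
        (fun x => lift (fun y => Φ (k - m, y)) (x - b)) x) := hm.mul (hs k)
    rw [e, iteratedFDeriv_const_smul_apply
      ((hp.of_le (by exact_mod_cast le_top)).contDiffAt), norm_smul]
    have hmul := norm_iteratedFDeriv_mul_le hm (hs k) x (n := i) (by exact_mod_cast le_top)
    have hk : (1 + ‖k‖) ^ M ≤ (1 + ‖m‖) ^ M * (1 + ‖k - m‖) ^ M := by
      rw [← mul_pow]
      refine pow_le_pow_left₀ (by positivity) ?_ _
      have : ‖k‖ ≤ ‖k - m‖ + ‖m‖ := by simpa using norm_add_le (k - m) m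
      nlinarith [norm_nonneg m, norm_nonneg (k - m)]
    calc (1 + ‖k‖) ^ M * (‖UnitAddTorus.mFourier k ξ.1‖ * _)
        ≤ (1 + ‖k‖) ^ M * (1 * ∑ j ∈ Finset.range (i + 1), (i.choose j : ℝ) *
            ‖iteratedFDeriv ℝ j (lift fun y => UnitAddTorus.mFourier ξ.2 y) x‖ *
            ‖iteratedFDeriv ℝ (i - j) (fun x => lift (fun y => Φ (k - m, y)) (x - b)) x‖) := by
          gcongr
      _ = ∑ j ∈ Finset.range (i + 1), (i.choose j : ℝ) *
            ‖iteratedFDeriv ℝ j (lift fun y => UnitAddTorus.mFourier ξ.2 y) x‖ *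
            ((1 + ‖k‖) ^ M * ‖iteratedFDeriv ℝ (i - j)
              (fun x => lift (fun y => Φ (k - m, y)) (x - b)) x‖) := by
          rw [one_mul, Finset.mul_sum]
          exact Finset.sum_congr rfl fun j _ => by ring
      _ ≤ _ := by
          refine Finset.sum_le_sum fun j _ => ?_
          have hj : (1 + ‖k‖) ^ M * ‖iteratedFDeriv ℝ (i - j)
              (fun x => lift (fun y => Φ (k - m, y)) (x - b)) x‖ ≤ (1 + ‖m‖) ^ M * D (i - j) := by
            rw [iteratedFDeriv_comp_sub]
            refine (mul_le_mul_of_nonneg_right hk (norm_nonneg _)).trans ?_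
            rw [mul_assoc]
            exact mul_le_mul_of_nonneg_left (hD (i - j) (k - m) (x - b)) (by positivity)
          refine mul_le_mul ?_ hj (by positivity) (mul_nonneg (by positivity) (hA0 j))
          exact mul_le_mul_of_nonneg_left (hA j x) (by positivity)

theorem IsSchwartzZT.conj {n : ℕ} {Φ : Zn n × Tn n → ℂ} (h : IsSchwartzZT Φ) :
    IsSchwartzZT fun q => conj (Φ q) := by
  obtain ⟨h1, h2⟩ := h
  have e : ∀ k, (lift fun y => conj (Φ (k, y))) =
      Complex.conjLIE ∘ (lift fun y => Φ (k, y)) := fun k => rfl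
  refine ⟨fun k => ?_, fun M i => ?_⟩
  · rw [e]; exact Complex.conjLIE.contDiff.comp (h1 k)
  · obtain ⟨C, hC⟩ := h2 M i
    refine ⟨C, fun k x => ?_⟩
    rw [e, LinearIsometryEquiv.norm_iteratedFDeriv_comp_left]
    exact hC k x

/-- The test function `conj (M_ξ T_z Φ)`. -/
def conjShift {n : ℕ} (Φ : schwartzZT n) (z : Zn n × Tn n) (ξ : Tn n × Zn n) : schwartzZT n :=
  ⟨fun q => conj (tfShiftZT z ξ Φ.1 q), (IsSchwartzZT.tfShift Φ.2 z ξ).conj⟩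

/-- The short-time Fourier transform `V_Φ σ (z, ξ) = ⟨σ, M_ξ T_z Φ⟩` of a tempered distribution on
`ℤⁿ × 𝕋ⁿ`; the sesquilinear pairing is `⟨σ, Ψ⟩ = σ (conj Ψ)`. -/
def stftZT {n : ℕ} (Φ : schwartzZT n) (σ : temperedZT n)
    (a : (Zn n × Tn n) × (Tn n × Zn n)) : ℂ :=
  σ.1 (conjShift Φ a.1 a.2)

/-- The modulation space `M^p(ℤⁿ × 𝕋ⁿ)` (with window `Φ`). -/
def modZT {n : ℕ} (Φ : schwartzZT n) (p : ℝ≥0∞) : Submodule ℂ (temperedZT n) where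
  carrier := {σ | MemLp (stftZT Φ σ) p (doublePhaseMeasure n)}
  zero_mem' := MemLp.zero (p := p) (μ := doublePhaseMeasure n)
  add_mem' := fun h h' => MemLp.add h h'
  smul_mem' := fun c _ h => MemLp.const_smul h c

/-- The norm of `M^p(ℤⁿ × 𝕋ⁿ)` (with window `Φ`). -/
def modNormZT {n : ℕ} (Φ : schwartzZT n) (p : ℝ≥0∞) (σ : temperedZT n) : ℝ :=
  (eLpNorm (stftZT Φ σ) p (doublePhaseMeasure n)).toReal

/-- The distribution `σ` is given by the function `s`. -/
def IsGivenBy {n : ℕ} (σ : temperedZT n) (s : Zn n × Tn n → ℂ) : Prop :=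
  ∀ Φ : schwartzZT n, σ.1 Φ = ∑' m, ∫ w, s (m, w) * Φ.1 (m, w) ∂torusMeasure n

/-! Localization operators. -/

/-- The Hilbert space `ℓ²(ℤⁿ)`. -/
abbrev ell2 (n : ℕ) := lp (fun _ : Zn n => ℂ) 2

/-- The localization operator with windows `g₁, g₂` and symbol `s`,
`f ↦ ∑ₘ ∫ s(m, w) V_{g₁} f(m, w) M_w T_m g₂ dw`, for `s` in `L¹ ∪ L^∞`. -/
def locOp {n : ℕ} (g₁ g₂ : Zn n → ℂ) (s : Zn n × Tn n → ℂ) (f : ell2 n) (k : Zn n) : ℂ :=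
  ∑' m, ∫ w, s (m, w) * stft g₁ f (m, w) * tfShift (m, w) g₂ k ∂torusMeasure n

/-- The linear map `𝓛` from `M^p(ℤⁿ × 𝕋ⁿ)` to the bounded operators on `ℓ²(ℤⁿ)` sends every symbol
in `S` that is a function in `L¹ ∪ L^∞` to its localization operator. -/
def ExtendsLocOp {n : ℕ} {Φ : schwartzZT n} {p : ℝ≥0∞} (g₁ g₂ : Zn n → ℂ)
    (𝓛 : modZT Φ p →ₗ[ℂ] (ell2 n →L[ℂ] ell2 n)) (S : Set (temperedZT n)) : Prop :=
  ∀ (σ : modZT Φ p) (s : Zn n × Tn n → ℂ), σ.1 ∈ S →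
    (MemLp s 1 (phaseMeasure n) ∨ MemLp s ⊤ (phaseMeasure n)) → IsGivenBy σ.1 s →
    ∀ (f : ell2 n) (k : Zn n), 𝓛 σ f k = locOp g₁ g₂ s f k

/-- `𝓛` is bounded from `M^p(ℤⁿ × 𝕋ⁿ)` to the bounded operators on `ℓ²(ℤⁿ)`. -/
def IsBoundedOnMod {n : ℕ} {Φ : schwartzZT n} {p : ℝ≥0∞}
    (𝓛 : modZT Φ p →ₗ[ℂ] (ell2 n →L[ℂ] ell2 n)) : Prop :=
  ∃ K : ℝ, ∀ σ : modZT Φ p, ‖𝓛 σ‖ ≤ K * modNormZT Φ p σ.1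

/-- With respect to the windows `φ` of `M¹(ℤⁿ)` and `Φ` of `M^p(ℤⁿ × 𝕋ⁿ)`, the operators
`L_σ^{g₁,g₂}` extend uniquely to all `σ ∈ M^p(ℤⁿ × 𝕋ⁿ)`, with the norm estimate with constant `C`.
The extension agrees with the defining formula for every symbol in `M^p ∩ (L¹ ∪ L^∞)`, and is
determined already by the symbols in `M¹ ∩ M^∞`. -/
def UniqueBoundedExtension {n : ℕ} (φ : Zn n → ℂ) (Φ : schwartzZT n) (C : ℝ) (p : ℝ≥0∞)
    (g₁ g₂ : Zn n → ℂ) : Prop :=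
  ∃ 𝓛 : modZT Φ p →ₗ[ℂ] (ell2 n →L[ℂ] ell2 n),
    ExtendsLocOp g₁ g₂ 𝓛 Set.univ ∧
    (∀ σ : modZT Φ p,
      ‖𝓛 σ‖ ≤ C * modNormZT Φ p σ.1 * modNorm φ 1 g₁ * modNorm φ 1 g₂) ∧
    ∀ 𝓛' : modZT Φ p →ₗ[ℂ] (ell2 n →L[ℂ] ell2 n), IsBoundedOnMod 𝓛' →
      ExtendsLocOp g₁ g₂ 𝓛' {σ | σ ∈ modZT Φ 1 ∧ σ ∈ modZT Φ ⊤} → 𝓛' = 𝓛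

end LocOp

end

/-!
Let `a_q` be the value of `σ` at the function `δ_k ⊗ e^{2πi j·}`, `q = (k, j)`. For fixed integer
variables, `V_Φ σ` is an absolutely convergent Fourier series in the two torus variables, whose
coefficients are products of a Fourier coefficient of `Φ` and one of the `a_q`. Integrating over the
torus gives `|Φ̂(q₀)| ‖a‖_p ≤ ‖σ‖_{M^p}` for each `q₀`, and Schur's test gives
`‖σ‖_{M^p} ≤ ‖Φ̂‖₁ ‖a‖_p`: thus `M^p(ℤⁿ × 𝕋ⁿ)` is `ℓ^p` of the Fourier coefficients. In the same way
`‖g‖₁` is bounded by `‖g‖_{M¹}`.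

In terms of the `a_q`, the operator `L_σ` is the sum over `(i, j)` of `conj g₁(i) g₂(j)` times a
translation followed by multiplication by a sequence of values of `a`, so its norm is at most
`‖a‖_∞ ‖g₁‖₁ ‖g₂‖₁`, and this defines it for every `σ ∈ M^p`. For `p < ∞` the trigonometric
polynomials, which are finite linear combinations of functions in `M¹ ∩ M^∞ ∩ L^∞`, are dense in
`M^p`; hence the extension is unique. The windows `δ₀` and `δ₀ ⊗ 1` give the constant `1`.
-/

noncomputable section

namespace LocOp

section Lp

variable {X Y I Z : Type*}

theorem tsum_mul_rpow_le (w f : I → ℝ≥0∞) {r : ℝ} (hr : 1 ≤ r) :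
    (∑' i, w i * f i) ^ r ≤ (∑' i, w i) ^ (r - 1) * ∑' i, w i * f i ^ r := by
  have hr0 : 0 < r := by linarith
  have h : ∑' i, w i * f i ≤ (∑' i, w i) ^ (1 - r⁻¹) * (∑' i, w i * f i ^ r) ^ r⁻¹ := by
    rw [ENNReal.tsum_eq_iSup_sum]
    refine iSup_le fun s => (ENNReal.inner_le_weight_mul_Lp_of_nonneg s hr w f).trans ?_
    gcongr
    · exact sub_nonneg.2 (inv_le_one_of_one_le₀ hr)
    · exact ENNReal.sum_le_tsum s
    · exact ENNReal.sum_le_tsum s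
  refine (ENNReal.rpow_le_rpow h hr0.le).trans_eq ?_
  rw [ENNReal.mul_rpow_of_nonneg _ _ hr0.le, ← ENNReal.rpow_mul, ENNReal.rpow_inv_rpow hr0.ne',
    sub_mul, one_mul, inv_mul_cancel₀ hr0.ne']

theorem tsum_tsum_mul_rpow_le {K : Z → I → ℝ≥0∞} {A : ℝ≥0∞} (hrow : ∀ z, ∑' i, K z i ≤ A)
    (hcol : ∀ i, ∑' z, K z i ≤ A) (f : I → ℝ≥0∞) {r : ℝ} (hr : 1 ≤ r) :
    ∑' z, (∑' i, K z i * f i) ^ r ≤ A ^ r * ∑' i, f i ^ r :=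
  calc ∑' z, (∑' i, K z i * f i) ^ r
      ≤ ∑' z, A ^ (r - 1) * ∑' i, K z i * f i ^ r := by
        gcongr with z
        refine (tsum_mul_rpow_le (K z) f hr).trans ?_
        gcongr
        exact hrow z
    _ = A ^ (r - 1) * ∑' i, (∑' z, K z i) * f i ^ r := by
        rw [ENNReal.tsum_mul_left, ENNReal.tsum_comm]
        simp only [ENNReal.tsum_mul_right]
    _ ≤ A ^ (r - 1) * ∑' i, A * f i ^ r := by
        gcongr with i
        exact hcol i
    _ = A ^ r * ∑' i, f i ^ r := by
        rw [ENNReal.tsum_mul_left, ← mul_assoc]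
        congr 1
        nth_rw 2 [← ENNReal.rpow_one A]
        rw [← ENNReal.rpow_add_of_nonneg _ _ (by linarith) zero_le_one, sub_add_cancel]

variable {E F : Type*} [ENorm E] [ENorm F]

theorem eLpNorm_count_eq_tsum [MeasurableSpace I] [MeasurableSingletonClass I] {p : ℝ≥0∞}
    (h0 : p ≠ 0) (htop : p ≠ ⊤) (f : I → E) :
    eLpNorm f p .count = (∑' i, ‖f i‖ₑ ^ p.toReal) ^ (1 / p.toReal) := by
  rw [eLpNorm_eq_lintegral_rpow_enorm_toReal h0 htop, lintegral_count]

theorem eLpNorm_top_count_eq_iSup [MeasurableSpace I] [MeasurableSingletonClass I] (f : I → E) :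
    eLpNorm f ⊤ .count = ⨆ i, ‖f i‖ₑ := by
  rw [eLpNorm_exponent_top, eLpNormEssSup, essSup_count]

theorem eLpNorm_single_count [MeasurableSpace I] [MeasurableSingletonClass I] [DecidableEq I]
    {E : Type*} [NormedAddCommGroup E] (i : I) (c : E) {p : ℝ≥0∞} (h0 : p ≠ 0) :
    eLpNorm (Pi.single i c : I → E) p .count = ‖c‖ₑ := by
  have hμ : Measure.count {i} = 1 := Measure.count_singleton i
  have hsingle : Pi.single i c = ({i} : Set I).indicator fun _ => c := by
    ext k
    simp only [Pi.single_apply, Set.indicator_apply, Set.mem_singleton_iff]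
  rw [hsingle, eLpNorm_indicator_const' (measurableSet_singleton i)
    (hμ.trans_ne one_ne_zero) h0, hμ, ENNReal.one_rpow, mul_one]

theorem one_le_toReal {p : ℝ≥0∞} (hp : 1 ≤ p) (htop : p ≠ ⊤) : 1 ≤ p.toReal := by
  simpa using ENNReal.toReal_mono htop hp

/-- Schur's test. -/
theorem eLpNorm_tsum_mul_le [MeasurableSpace I] [MeasurableSingletonClass I] [MeasurableSpace Z]
    [MeasurableSingletonClass Z] {K : Z → I → ℝ≥0∞} {A : ℝ≥0∞} (hrow : ∀ z, ∑' i, K z i ≤ A)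
    (hcol : ∀ i, ∑' z, K z i ≤ A) (f : I → E) {p : ℝ≥0∞} (hp : 1 ≤ p) :
    eLpNorm (fun z => ∑' i, K z i * ‖f i‖ₑ) p .count ≤ A * eLpNorm f p .count := by
  rcases eq_or_ne p ⊤ with rfl | htop
  · simp only [eLpNorm_top_count_eq_iSup, enorm_eq_self]
    refine iSup_le fun z => ?_
    calc ∑' i, K z i * ‖f i‖ₑ ≤ ∑' i, K z i * ⨆ i, ‖f i‖ₑ := by
          gcongr with i
          exact le_iSup (fun i => ‖f i‖ₑ) i
      _ ≤ A * ⨆ i, ‖f i‖ₑ := by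
          rw [ENNReal.tsum_mul_right]
          gcongr
          exact hrow z
  · have h0 : p ≠ 0 := (zero_lt_one.trans_le hp).ne'
    have hr := one_le_toReal hp htop
    have hr0 : p.toReal ≠ 0 := by positivity
    simp only [eLpNorm_count_eq_tsum h0 htop, enorm_eq_self]
    refine (ENNReal.rpow_le_rpow (tsum_tsum_mul_rpow_le hrow hcol _ hr)
      (by positivity)).trans_eq ?_
    rw [ENNReal.mul_rpow_of_nonneg _ _ (by positivity), one_div, ENNReal.rpow_rpow_inv hr0]

theorem eLpNorm_comp_le_of_injective [MeasurableSpace I] [MeasurableSingletonClass I]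
    [MeasurableSpace Z] [MeasurableSingletonClass Z] {e : I → Z} (he : Function.Injective e)
    (f : Z → E) {p : ℝ≥0∞} (h0 : p ≠ 0) :
    eLpNorm (f ∘ e) p .count ≤ eLpNorm f p .count := by
  rcases eq_or_ne p ⊤ with rfl | htop
  · simp only [eLpNorm_top_count_eq_iSup]
    exact iSup_comp_le (fun z => ‖f z‖ₑ) e
  · simp only [eLpNorm_count_eq_tsum h0 htop]
    gcongr
    exact ENNReal.tsum_comp_le_tsum_of_injective he fun z => ‖f z‖ₑ ^ p.toReal

theorem tendsto_eLpNorm_indicator_compl [MeasurableSpace I] [MeasurableSingletonClass I]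
    {E : Type*} [NormedAddCommGroup E] {p : ℝ≥0∞} (h0 : p ≠ 0) (htop : p ≠ ⊤) {f : I → E}
    (hf : eLpNorm f p .count ≠ ⊤) :
    Filter.Tendsto (fun s : Finset I => eLpNorm ((s : Set I)ᶜ.indicator f) p .count)
      Filter.atTop (nhds 0) := by
  have hr := ENNReal.toReal_pos h0 htop
  have hsum : ∑' i, ‖f i‖ₑ ^ p.toReal ≠ ⊤ := by
    rw [eLpNorm_count_eq_tsum h0 htop] at hf
    exact fun h => hf (by rw [h, ENNReal.top_rpow_of_pos (by positivity)])
  have h := (ENNReal.tendsto_tsum_compl_atTop_zero hsum).ennrpow_const (1 / p.toReal)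
  rw [ENNReal.zero_rpow_of_pos (by positivity)] at h
  refine h.congr fun s => ?_
  rw [eLpNorm_count_eq_tsum h0 htop]
  congr 1
  refine (tsum_subtype (s : Set I)ᶜ fun i => ‖f i‖ₑ ^ p.toReal).trans (tsum_congr fun i => ?_)
  by_cases hi : i ∈ s <;> simp [hi, hr]

theorem eLpNorm_lintegral_enorm_le [MeasurableSpace X] [MeasurableSpace Y] {ν : Measure X}
    {μ : Measure Y} [SFinite ν] [IsProbabilityMeasure μ] {E : Type*} [NormedAddCommGroup E]
    {f : X × Y → E} (hf : AEStronglyMeasurable f (ν.prod μ)) {p : ℝ≥0∞} (hp : 1 ≤ p) :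
    eLpNorm (fun x => ∫⁻ y, ‖f (x, y)‖ₑ ∂μ) p ν ≤ eLpNorm f p (ν.prod μ) := by
  have hslice : ∀ q : ℝ≥0∞, 1 ≤ q → ∀ᵐ x ∂ν,
      ∫⁻ y, ‖f (x, y)‖ₑ ∂μ ≤ eLpNorm (fun y => f (x, y)) q μ := fun q hq => by
    filter_upwards [hf.prodMk_left] with x hx
    rw [← eLpNorm_one_eq_lintegral_enorm]
    exact eLpNorm_le_eLpNorm_of_exponent_le hq hx
  rcases eq_or_ne p ⊤ with rfl | htop
  · simp only [eLpNorm_exponent_top] at hslice ⊢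
    refine eLpNormEssSup_le_of_ae_enorm_bound ?_
    filter_upwards [hslice ⊤ le_top,
      Measure.ae_ae_of_ae_prod (enorm_ae_le_eLpNormEssSup f (ν.prod μ))] with x hx hfx
    exact hx.trans (eLpNormEssSup_le_of_ae_enorm_bound hfx)
  · have h0 : p ≠ 0 := (zero_lt_one.trans_le hp).ne'
    have hr0 : 0 < p.toReal := ENNReal.toReal_pos h0 htop
    rw [eLpNorm_eq_lintegral_rpow_enorm_toReal h0 htop,
      eLpNorm_eq_lintegral_rpow_enorm_toReal h0 htop, lintegral_prod _ (hf.enorm.pow_const _)]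
    gcongr ?_ ^ _
    refine lintegral_mono_ae ?_
    filter_upwards [hslice p hp] with x hx
    rw [eLpNorm_eq_lintegral_rpow_enorm_toReal h0 htop, one_div] at hx
    exact (ENNReal.le_rpow_inv_iff hr0).1 hx

theorem eLpNorm_count_le_eLpNorm_prod [Countable Z] [MeasurableSpace Z] [MeasurableSingletonClass Z]
    [MeasurableSpace I] [MeasurableSingletonClass I] [MeasurableSpace Y] {μ : Measure Y}
    [IsProbabilityMeasure μ] {E : Type*} [NormedAddCommGroup E] {f : Z × Y → E}
    (hf : AEStronglyMeasurable f (Measure.count.prod μ)) {e : I → Z} (he : Function.Injective e)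
    {a : I → F} (ha : ∀ i, ‖a i‖ₑ ≤ ∫⁻ y, ‖f (e i, y)‖ₑ ∂μ) {p : ℝ≥0∞} (hp : 1 ≤ p) :
    eLpNorm a p .count ≤ eLpNorm f p (Measure.count.prod μ) :=
  calc eLpNorm a p .count
      ≤ eLpNorm ((fun z => ∫⁻ y, ‖f (z, y)‖ₑ ∂μ) ∘ e) p .count :=
        eLpNorm_mono_enorm fun i => ha i
    _ ≤ eLpNorm (fun z => ∫⁻ y, ‖f (z, y)‖ₑ ∂μ) p .count :=
        eLpNorm_comp_le_of_injective he _ (zero_lt_one.trans_le hp).ne'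
    _ ≤ eLpNorm f p (Measure.count.prod μ) := eLpNorm_lintegral_enorm_le hf hp

theorem eLpNorm_prod_le_of_enorm_le [MeasurableSpace X] [MeasurableSpace Y] {ν : Measure X}
    {μ : Measure Y} [SFinite ν] [IsProbabilityMeasure μ] {f : X × Y → E} {b : X → ℝ≥0∞}
    (hb : Measurable b) (h : ∀ x y, ‖f (x, y)‖ₑ ≤ b x) (p : ℝ≥0∞) :
    eLpNorm f p (ν.prod μ) ≤ eLpNorm b p ν :=
  calc eLpNorm f p (ν.prod μ) ≤ eLpNorm (b ∘ Prod.fst) p (ν.prod μ) :=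
        eLpNorm_mono_enorm fun z => h z.1 z.2
    _ = eLpNorm b p ν :=
        eLpNorm_comp_measurePreserving hb.aestronglyMeasurable measurePreserving_fst

theorem measurePreserving_prodProdProdComm {A B C D : Type*} [MeasurableSpace A]
    [MeasurableSpace B] [MeasurableSpace C] [MeasurableSpace D] (α : Measure A) (β : Measure B)
    (γ : Measure C) (δ : Measure D) [SFinite α] [SFinite β] [SFinite γ] [SFinite δ] :
    MeasurePreserving (fun x : (A × B) × (C × D) => ((x.1.1, x.2.1), (x.1.2, x.2.2)))
      ((α.prod β).prod (γ.prod δ)) ((α.prod γ).prod (β.prod δ)) :=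
  have hswap : MeasurePreserving (fun x : B × (C × D) => (x.2.1, (x.1, x.2.2)))
      (β.prod (γ.prod δ)) (γ.prod (β.prod δ)) :=
    (measurePreserving_prodAssoc γ β δ).comp
      (((Measure.measurePreserving_swap (μ := β) (ν := γ)).prod (.id δ)).comp
        (measurePreserving_prodAssoc β γ δ).symm)
  (measurePreserving_prodAssoc α γ (β.prod δ)).symm.comp
    (((MeasurePreserving.id α).prod hswap).comp (measurePreserving_prodAssoc α β (γ.prod δ)))

theorem count_prod_count [MeasurableSpace X] [MeasurableSpace Y] [MeasurableSingletonClass X]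
    [MeasurableSingletonClass Y] [Countable X] [Countable Y] :
    (Measure.count : Measure X).prod (Measure.count : Measure Y) = Measure.count :=
  Measure.ext_of_singleton fun x => by
    rw [← Set.singleton_prod_singleton, Measure.prod_prod]
    simp

end Lp

section UnimodularSystem

variable {ι κ X Y : Type*} [MeasurableSpace X] {μ : Measure X} {χ : ι → X → ℂ}

theorem hasSum_mul_integral_mul [Countable ι] {u : X → ℂ} (hu : Integrable u μ) {c : ι → ℂ}
    (hc : Summable c) (hχ : ∀ l, AEStronglyMeasurable (χ l) μ) (hχ_le : ∀ l x, ‖χ l x‖ ≤ 1) :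
    HasSum (fun l => c l * ∫ x, u x * χ l x ∂μ) (∫ x, u x * ∑' l, c l * χ l x ∂μ) := by
  have hint : ∀ l, Integrable (fun x => u x * χ l x) μ := fun l =>
    hu.mul_bdd (hχ l) (.of_forall (hχ_le l))
  have hle : ∀ l, ∫ x, ‖c l * (u x * χ l x)‖ ∂μ ≤ ‖c l‖ * ∫ x, ‖u x‖ ∂μ := fun l => by
    rw [← integral_const_mul]
    refine integral_mono ((hint l).const_mul _).norm (hu.norm.const_mul _) fun x => ?_
    simp only [norm_mul]
    gcongr
    exact mul_le_of_le_one_right (norm_nonneg _) (hχ_le l x)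
  have hsum := hasSum_integral_of_summable_integral_norm (fun l => (hint l).const_mul (c l))
    ((hc.norm.mul_right _).of_nonneg_of_le
      (fun l => integral_nonneg fun x => norm_nonneg _) hle)
  simp only [mul_left_comm (c _), tsum_mul_left] at hsum
  simpa only [mul_left_comm _ (c _), integral_const_mul] using hsum

/-- A family of functions of modulus `1` which are pairwise orthogonal in `L²(μ)`, such as the
characters of a compact abelian group. -/
structure IsUnimodularSystem (μ : Measure X) (χ : ι → X → ℂ) : Prop where
  aestronglyMeasurable : ∀ l, AEStronglyMeasurable (χ l) μ
  norm_eq_one : ∀ l x, ‖χ l x‖ = 1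
  integral_mul_conj : ∀ l i, l ≠ i → ∫ x, χ l x * conj (χ i x) ∂μ = 0

namespace IsUnimodularSystem

theorem mul_conj_self (h : IsUnimodularSystem μ χ) (i : ι) (x : X) : χ i x * conj (χ i x) = 1 := by
  rw [Complex.mul_conj, Complex.normSq_eq_norm_sq, h.norm_eq_one]
  simp

theorem comp_injective (h : IsUnimodularSystem μ χ) {e : κ → ι} (he : Function.Injective e) :
    IsUnimodularSystem μ fun l => χ (e l) where
  aestronglyMeasurable l := h.aestronglyMeasurable (e l)
  norm_eq_one l := h.norm_eq_one (e l)
  integral_mul_conj l i hli := h.integral_mul_conj (e l) (e i) (he.ne hli)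

theorem prod [MeasurableSpace Y] {ν : Measure Y} [SFinite μ] [SFinite ν] {η : κ → Y → ℂ}
    (h : IsUnimodularSystem μ χ) (h' : IsUnimodularSystem ν η) :
    IsUnimodularSystem (μ.prod ν) fun (l : ι × κ) (z : X × Y) => χ l.1 z.1 * η l.2 z.2 where
  aestronglyMeasurable l :=
    (h.aestronglyMeasurable l.1).comp_fst.mul (h'.aestronglyMeasurable l.2).comp_snd
  norm_eq_one l z := by rw [norm_mul, h.norm_eq_one, h'.norm_eq_one, one_mul]
  integral_mul_conj l i hli := by
    have hsplit : ∀ z : X × Y, χ l.1 z.1 * η l.2 z.2 * conj (χ i.1 z.1 * η i.2 z.2) =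
        χ l.1 z.1 * conj (χ i.1 z.1) * (η l.2 z.2 * conj (η i.2 z.2)) := fun z => by
      rw [map_mul, mul_mul_mul_comm]
    simp only [hsplit]
    rw [integral_prod_mul (fun x => χ l.1 x * conj (χ i.1 x)) fun y => η l.2 y * conj (η i.2 y)]
    by_cases h1 : l.1 = i.1
    · rw [h'.integral_mul_conj _ _ fun h2 => hli (Prod.ext h1 h2), mul_zero]
    · rw [h.integral_mul_conj _ _ h1, zero_mul]

theorem integral_tsum_mul_conj [IsProbabilityMeasure μ] [Countable ι] (h : IsUnimodularSystem μ χ)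
    {c : ι → ℂ} (hc : Summable c) (i : ι) :
    ∫ x, (∑' l, c l * χ l x) * conj (χ i x) ∂μ = c i := by
  have hconj : Integrable (fun x => conj (χ i x)) μ := .of_bound
    (Complex.continuous_conj.comp_aestronglyMeasurable (h.aestronglyMeasurable i)) 1
    (.of_forall fun x => by rw [RCLike.norm_conj, h.norm_eq_one])
  have hsum := hasSum_mul_integral_mul hconj hc h.aestronglyMeasurable fun l x =>
    (h.norm_eq_one l x).le
  simp only [mul_comm (conj (χ i _))] at hsum
  rw [← hsum.tsum_eq,
    tsum_eq_single i fun l hl => by rw [h.integral_mul_conj l i hl, mul_zero]]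
  simp only [h.mul_conj_self, integral_const, probReal_univ, one_smul, mul_one]

theorem enorm_coeff_le_lintegral [IsProbabilityMeasure μ] [Countable ι]
    (h : IsUnimodularSystem μ χ) {c : ι → ℂ} (hc : Summable c) (i : ι) :
    ‖c i‖ₑ ≤ ∫⁻ x, ‖∑' l, c l * χ l x‖ₑ ∂μ := by
  have hone : ∀ x, ‖conj (χ i x)‖ₑ = 1 := fun x => by
    rw [RCLike.enorm_conj, ← ofReal_norm, h.norm_eq_one, ENNReal.ofReal_one]
  conv_lhs => rw [← h.integral_tsum_mul_conj hc i]
  refine (enorm_integral_le_lintegral_enorm _).trans_eq ?_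
  simp only [enorm_mul, hone, mul_one]

end IsUnimodularSystem

end UnimodularSystem

section Characters

open UnitAddTorus

variable {d : Type*} [Fintype d]

theorem norm_mFourier_apply (j : d → ℤ) (y : UnitAddTorus d) : ‖mFourier j y‖ = 1 := by
  simp only [mFourier, fourier_apply, ContinuousMap.coe_mk, norm_prod, Circle.norm_coe,
    Finset.prod_const_one]

theorem enorm_mFourier_apply (j : d → ℤ) (y : UnitAddTorus d) : ‖mFourier j y‖ₑ = 1 := by
  rw [← ofReal_norm, norm_mFourier_apply, ENNReal.ofReal_one]

theorem mFourier_apply_add (j : d → ℤ) (y z : UnitAddTorus d) :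
    mFourier j (y + z) = mFourier j y * mFourier j z := by
  simp only [mFourier, ContinuousMap.coe_mk, fourier_apply, Pi.add_apply, smul_add,
    AddCircle.toCircle_add, Circle.coe_mul, Finset.prod_mul_distrib]

theorem measurable_uncurry_mFourier :
    Measurable fun p : (d → ℤ) × UnitAddTorus d => mFourier p.1 p.2 :=
  measurable_from_prod_countable_right fun j => (mFourier j).continuous.measurable

theorem measurable_mFourier_comp {X : Type*} [MeasurableSpace X] {f : X → d → ℤ}
    {g : X → UnitAddTorus d} (hf : Measurable f) (hg : Measurable g) :
    Measurable fun a => mFourier (f a) (g a) := by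
  simpa only [Function.comp_def] using measurable_uncurry_mFourier.comp (hf.prodMk hg)

theorem isUnimodularSystem_mFourier (n : ℕ) :
    IsUnimodularSystem (torusMeasure n) fun (j : Zn n) y => mFourier j y where
  aestronglyMeasurable j := (mFourier j).continuous.aestronglyMeasurable
  norm_eq_one := norm_mFourier_apply
  integral_mul_conj l i hli := by
    have h := (orthonormal_mFourier (d := Fin n)).2 hli.symm
    beta_reduce at h
    rwa [ContinuousMap.inner_toLp] at h

instance (n : ℕ) : IsProbabilityMeasure (torusMeasure n) :=
  inferInstanceAs (IsProbabilityMeasure (Measure.pi _))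

instance (n : ℕ) : (torusMeasure n).IsAddLeftInvariant :=
  inferInstanceAs (Measure.IsAddLeftInvariant (Measure.pi _))

theorem mFourierCoeff_eq_integral_torusMeasure {n : ℕ} (u : Tn n → ℂ) (j : Zn n) :
    mFourierCoeff u j = ∫ y, mFourier (-j) y * u y ∂torusMeasure n := rfl

theorem mFourierCoeff_mFourier {n : ℕ} (i j : Zn n) :
    mFourierCoeff (mFourier i) j = if i = j then 1 else 0 := by
  simp only [mFourierCoeff_eq_integral_torusMeasure, mFourier_neg, mul_comm (conj _)]
  split_ifs with hij
  · simp [hij, (isUnimodularSystem_mFourier n).mul_conj_self j]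
  · exact (isUnimodularSystem_mFourier n).integral_mul_conj i j hij

end Characters

section Lattice

theorem summable_inv_one_add_abs_sq : Summable fun t : ℤ => ((1 + |(t : ℝ)|) ^ 2)⁻¹ := by
  have h : Summable fun k : ℕ => ((1 + (k : ℝ)) ^ 2)⁻¹ := by
    refine ((summable_nat_add_iff 1).2 (Real.summable_nat_pow_inv.2 one_lt_two)).congr fun k => ?_
    push_cast
    rw [add_comm]
  exact .of_nat_of_neg (by simpa using h) (by simpa using h)

theorem summable_prod_apply {α : Type*} {f : α → ℝ} (hf : Summable f) (h0 : ∀ a, 0 ≤ f a)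
    (n : ℕ) : Summable fun k : Fin n → α => ∏ i, f (k i) := by
  induction n with
  | zero => exact .of_finite
  | succ n ih =>
    have h := hf.mul_of_nonneg ih h0 fun k => Finset.prod_nonneg fun i _ => h0 (k i)
    refine ((Fin.consEquiv fun _ => α).summable_iff).1 (h.congr fun x => ?_)
    simp [Fin.prod_univ_succ, Fin.consEquiv]

theorem summable_inv_one_add_norm_pow (n : ℕ) :
    Summable fun k : Zn n => ((1 + ‖k‖) ^ (2 * n))⁻¹ := by
  have hprod := summable_prod_apply summable_inv_one_add_abs_sq (fun _ => by positivity) n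
  refine hprod.of_nonneg_of_le (fun _ => by positivity) fun k => ?_
  rw [Finset.prod_inv_distrib]
  refine inv_anti₀ (Finset.prod_pos fun _ _ => by positivity) ?_
  calc ∏ i, (1 + |(k i : ℝ)|) ^ 2 ≤ ∏ _i : Fin n, (1 + ‖k‖) ^ 2 := by
        gcongr with i
        simpa only [Int.norm_eq_abs] using norm_le_pi_norm k i
    _ = (1 + ‖k‖) ^ (2 * n) := by
        rw [Finset.prod_const, Finset.card_univ, Fintype.card_fin, pow_mul]

end Lattice

section TorusDerivative

open UnitAddTorus

variable {n : ℕ} {u : Tn n → ℂ}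

/-- The quotient map `ℝⁿ → 𝕋ⁿ`. -/
def toTorus (x : Fin n → ℝ) : Tn n := fun i => (x i : UnitAddCircle)

theorem toTorus_add (x y : Fin n → ℝ) : toTorus (x + y) = toTorus x + toTorus y := rfl

theorem toTorus_zero : toTorus (0 : Fin n → ℝ) = 0 := rfl

theorem isOpenQuotientMap_toTorus : IsOpenQuotientMap (toTorus (n := n)) :=
  .piMap fun _ => QuotientAddGroup.isOpenQuotientMap_mk

theorem lift_apply (u : Tn n → ℂ) (x : Fin n → ℝ) : lift u x = u (toTorus x) := rfl

theorem continuous_lift_iff : Continuous (lift u) ↔ Continuous u :=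
  isOpenQuotientMap_toTorus.isQuotientMap.continuous_iff.symm

/-- The `i`-th partial derivative of a function on the torus. -/
def torusPartial (i : Fin n) (u : Tn n → ℂ) (y : Tn n) : ℂ :=
  deriv (fun t : ℝ => u (y + toTorus (Pi.single i t))) 0

theorem hasDerivAt_comp_toTorus_add_single (hu : Differentiable ℝ (lift u)) (i : Fin n)
    (x : Fin n → ℝ) (t : ℝ) :
    HasDerivAt (fun t : ℝ => u (toTorus x + toTorus (Pi.single i t)))
      (fderiv ℝ (lift u) (x + Pi.single i t) (Pi.single i 1)) t := by
  have hline : HasDerivAt (fun t : ℝ => x + Pi.single i t) (Pi.single i 1) t :=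
    (hasDerivAt_single i t).const_add x
  exact (hu _).hasFDerivAt.comp_hasDerivAt t hline

theorem lift_torusPartial (hu : Differentiable ℝ (lift u)) (i : Fin n) :
    lift (torusPartial i u) = fun x => fderiv ℝ (lift u) x (Pi.single i 1) := by
  funext x
  rw [lift_apply, torusPartial, (hasDerivAt_comp_toTorus_add_single hu i x 0).deriv,
    Pi.single_zero, add_zero]

theorem hasDerivAt_translate (hu : Differentiable ℝ (lift u)) (i : Fin n) (y : Tn n) (t : ℝ) :
    HasDerivAt (fun t : ℝ => u (y + toTorus (Pi.single i t)))
      (torusPartial i u (y + toTorus (Pi.single i t))) t := by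
  obtain ⟨x, rfl⟩ := isOpenQuotientMap_toTorus.surjective y
  rw [← toTorus_add, ← lift_apply (torusPartial i u), lift_torusPartial hu]
  exact hasDerivAt_comp_toTorus_add_single hu i x t

theorem contDiff_lift_torusPartial {N : ℕ} (hu : ContDiff ℝ (N + 1 : ℕ) (lift u)) (i : Fin n) :
    ContDiff ℝ N (lift (torusPartial i u)) := by
  rw [lift_torusPartial (hu.differentiable (by simp))]
  exact (hu.fderiv_right (by simp)).clm_apply contDiff_const

theorem norm_iteratedFDeriv_lift_torusPartial_le {N : ℕ} (hu : ContDiff ℝ (N + 1 : ℕ) (lift u))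
    (i : Fin n) (x : Fin n → ℝ) :
    ‖iteratedFDeriv ℝ N (lift (torusPartial i u)) x‖ ≤
      ‖iteratedFDeriv ℝ (N + 1) (lift u) x‖ := by
  have hd : ContDiff ℝ N (fderiv ℝ (lift u)) := hu.fderiv_right (by simp)
  rw [lift_torusPartial (hu.differentiable (by simp)), ← norm_iteratedFDeriv_fderiv]
  simpa [Pi.norm_single] using
    norm_iteratedFDeriv_clm_apply_const (c := Pi.single i (1 : ℝ)) (x := x) hd.contDiffAt le_rfl

theorem integral_torusPartial (hu : ContDiff ℝ 1 (lift u)) (i : Fin n) :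
    ∫ y, torusPartial i u y ∂torusMeasure n = 0 := by
  have hcont : Continuous u := continuous_lift_iff.1 hu.continuous
  have hcont' : Continuous (torusPartial i u) :=
    continuous_lift_iff.1 (contDiff_lift_torusPartial (N := 0) hu i).continuous
  obtain ⟨C, hC⟩ := isCompact_univ.exists_bound_of_continuousOn hcont'.continuousOn
  have hderiv := (hasDerivAt_integral_of_dominated_loc_of_deriv_le (μ := torusMeasure n)
    (F := fun (t : ℝ) y => u (y + toTorus (Pi.single i t)))
    (F' := fun t y => torusPartial i u (y + toTorus (Pi.single i t)))
    (x₀ := 0) (bound := fun _ => C) Filter.univ_mem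
    (.of_forall fun t => (hcont.comp (continuous_add_const _)).aestronglyMeasurable)
    ((hcont.comp (continuous_add_const _)).integrable_of_hasCompactSupport (.of_compactSpace _))
    (hcont'.comp (continuous_add_const _)).aestronglyMeasurable
    (.of_forall fun y t _ => hC _ trivial) (integrable_const C)
    (.of_forall fun y t _ => hasDerivAt_translate (hu.differentiable (by simp)) i y t)).2
  simp only [integral_add_right_eq_self] at hderiv
  exact hderiv.unique (hasDerivAt_const _ _)

theorem torusPartial_mFourier_mul (hu : Differentiable ℝ (lift u)) (i : Fin n) (j : Zn n)
    (y : Tn n) :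
    torusPartial i (fun y => mFourier j y * u y) y =
      2 * Real.pi * Complex.I * j i * (mFourier j y * u y) + mFourier j y * torusPartial i u y := by
  have hchar : HasDerivAt (fun t : ℝ => mFourier j (y + toTorus (Pi.single i t)))
      (2 * Real.pi * Complex.I * j i * mFourier j y) 0 := by
    have hexp : ∀ t : ℝ, mFourier j (y + toTorus (Pi.single i t)) =
        mFourier j y * Complex.exp (2 * Real.pi * Complex.I * j i * t) := fun t => by
      rw [mFourier_apply_add, ← lift_apply (fun y => mFourier j y), lift_mFourier]
      simp [dotForm, Pi.single_apply, mul_assoc]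
    have h := (((Complex.ofRealCLM.hasDerivAt (x := 0)).const_mul
      (2 * Real.pi * Complex.I * j i)).cexp).const_mul (mFourier j y)
    simp only [hexp]
    convert! h using 1
    simp only [Complex.ofRealCLM_apply, Complex.ofReal_zero, mul_zero, Complex.exp_zero,
      Complex.ofReal_one, mul_one, one_mul]
    ring
  have hmul := hchar.mul (hasDerivAt_translate hu i y 0)
  rw [Pi.single_zero, toTorus_zero, add_zero] at hmul
  rw [torusPartial, ← mul_assoc]
  exact hmul.deriv

theorem mFourierCoeff_torusPartial (hu : ContDiff ℝ 1 (lift u)) (i : Fin n) (j : Zn n) :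
    mFourierCoeff (torusPartial i u) j = 2 * Real.pi * Complex.I * j i * mFourierCoeff u j := by
  have hchar : Continuous fun y => mFourier (-j) y := (mFourier (-j)).continuous
  have hint : Integrable (fun y => mFourier (-j) y * u y) (torusMeasure n) :=
    (hchar.mul (continuous_lift_iff.1 hu.continuous)).integrable_of_hasCompactSupport
      (.of_compactSpace _)
  have hint' : Integrable (fun y => mFourier (-j) y * torusPartial i u y) (torusMeasure n) :=
    (hchar.mul (continuous_lift_iff.1
      (contDiff_lift_torusPartial (N := 0) hu i).continuous)).integrable_of_hasCompactSupport
      (.of_compactSpace _)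
  have hzero := integral_torusPartial (u := fun y => mFourier (-j) y * u y)
    (((contDiff_lift_mFourier (-j)).of_le (by simp)).mul hu) i
  simp only [torusPartial_mFourier_mul (hu.differentiable (by simp))] at hzero
  rw [integral_add (hint.const_mul _) hint', integral_const_mul] at hzero
  simp only [Pi.neg_apply, Int.cast_neg] at hzero
  simp only [mFourierCoeff_eq_integral_torusMeasure]
  linear_combination hzero

theorem norm_mFourierCoeff_le {B : ℝ} (hB : ∀ y, ‖u y‖ ≤ B) (j : Zn n) :
    ‖mFourierCoeff u j‖ ≤ B := by
  have h := norm_integral_le_of_norm_le_const (μ := torusMeasure n)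
    (f := fun y => mFourier (-j) y * u y)
    (.of_forall fun y => by simpa only [norm_mul, norm_mFourier_apply, one_mul] using hB y)
  rwa [probReal_univ, mul_one] at h

theorem pow_mul_norm_mFourierCoeff_le {N : ℕ} (hu : ContDiff ℝ N (lift u)) {B : ℝ}
    (hB : ∀ x, ‖iteratedFDeriv ℝ N (lift u) x‖ ≤ B) (i : Fin n) (j : Zn n) :
    ‖j i‖ ^ N * ‖mFourierCoeff u j‖ ≤ B := by
  induction N generalizing u with
  | zero =>
    simp only [norm_iteratedFDeriv_zero, lift_apply] at hB
    rw [pow_zero, one_mul]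
    exact norm_mFourierCoeff_le (isOpenQuotientMap_toTorus.surjective.forall.2 hB) j
  | succ N ih =>
    have hfreq : ‖j i‖ * ‖mFourierCoeff u j‖ ≤ ‖mFourierCoeff (torusPartial i u) j‖ := by
      rw [mFourierCoeff_torusPartial (hu.of_le (by simp)), norm_mul]
      gcongr
      rw [norm_mul, Complex.norm_intCast, ← Int.norm_eq_abs]
      refine le_mul_of_one_le_left (norm_nonneg _) ?_
      simp only [Complex.norm_mul, Complex.norm_ofNat, Complex.norm_real, Real.norm_eq_abs,
        abs_of_pos Real.pi_pos, Complex.norm_I, mul_one]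
      linarith [Real.pi_gt_three]
    calc ‖j i‖ ^ (N + 1) * ‖mFourierCoeff u j‖
        = ‖j i‖ ^ N * (‖j i‖ * ‖mFourierCoeff u j‖) := by ring
      _ ≤ ‖j i‖ ^ N * ‖mFourierCoeff (torusPartial i u) j‖ := by gcongr
      _ ≤ B := ih (contDiff_lift_torusPartial hu i) fun x =>
          (norm_iteratedFDeriv_lift_torusPartial_le hu i x).trans (hB x)

theorem one_add_norm_pow_mul_norm_mFourierCoeff_le {N : ℕ} (hu : ContDiff ℝ N (lift u)) {B : ℝ}
    (hB : ∀ i ≤ N, ∀ x, ‖iteratedFDeriv ℝ i (lift u) x‖ ≤ B) (j : Zn n) :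
    (1 + ‖j‖) ^ N * ‖mFourierCoeff u j‖ ≤ 2 ^ N * B := by
  have hcoeff : ‖mFourierCoeff u j‖ ≤ B := norm_mFourierCoeff_le
    (isOpenQuotientMap_toTorus.surjective.forall.2 fun x => by
      simpa only [norm_iteratedFDeriv_zero, lift_apply] using hB 0 N.zero_le x) j
  rcases eq_or_ne j 0 with rfl | hj
  · rw [norm_zero, add_zero, one_pow, one_mul]
    exact hcoeff.trans (le_mul_of_one_le_left ((norm_nonneg _).trans hcoeff)
      (one_le_pow₀ one_le_two))
  · obtain ⟨i, hi⟩ := Function.ne_iff.1 hj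
    have hone : 1 ≤ ‖j‖ := by
      refine le_trans ?_ (norm_le_pi_norm j i)
      rw [Int.norm_eq_abs]
      exact_mod_cast Int.one_le_abs hi
    obtain ⟨l, hl⟩ : ∃ l, ‖j‖ ≤ ‖j l‖ := by
      by_contra! h
      exact ((pi_norm_lt_iff (one_pos.trans_le hone)).2 h).false
    calc (1 + ‖j‖) ^ N * ‖mFourierCoeff u j‖
        ≤ (2 * ‖j l‖) ^ N * ‖mFourierCoeff u j‖ := by gcongr; linarith
      _ = 2 ^ N * (‖j l‖ ^ N * ‖mFourierCoeff u j‖) := by rw [mul_pow, mul_assoc]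
      _ ≤ 2 ^ N * B := by
          gcongr
          exact pow_mul_norm_mFourierCoeff_le hu (hB N le_rfl) l j

theorem norm_dotForm_le (j : Zn n) : ‖dotForm j‖ ≤ n * ‖j‖ := by
  refine ContinuousLinearMap.opNorm_le_bound _ (by positivity) fun x => ?_
  calc ‖dotForm j x‖ = ‖∑ i, (j i : ℝ) * x i‖ := by simp [dotForm]
    _ ≤ ∑ _i : Fin n, ‖j‖ * ‖x‖ := by
        refine (norm_sum_le _ _).trans (Finset.sum_le_sum fun i _ => ?_)
        rw [norm_mul, Int.norm_cast_real]
        exact mul_le_mul (norm_le_pi_norm j i) (norm_le_pi_norm x i) (norm_nonneg _)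
          (norm_nonneg _)
    _ = n * ‖j‖ * ‖x‖ := by simp [mul_assoc]

theorem norm_iteratedFDeriv_lift_mFourier_le (j : Zn n) (i : ℕ) (x : Fin n → ℝ) :
    ‖iteratedFDeriv ℝ i (lift fun y => mFourier j y) x‖ ≤
      (2 * Real.pi * (n * ‖j‖)) ^ i := by
  rw [lift_mFourier, (dotForm j).iteratedFDeriv_comp_right (contDiff_exp_char _) x (i := i)
    (by exact_mod_cast le_top)]
  refine (ContinuousMultilinearMap.norm_compContinuousLinearMap_le _ _).trans ?_
  have hphase : ((2 * Real.pi * Complex.I : ℂ) * (dotForm j x : ℝ)).re = 0 := by simp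
  have hconst : ‖(2 * Real.pi * Complex.I : ℂ)‖ = 2 * Real.pi := by simp [abs_of_pos Real.pi_pos]
  rw [norm_iteratedFDeriv_eq_norm_iteratedDeriv, iteratedDeriv_exp_char, norm_mul, norm_pow,
    Complex.norm_exp, Finset.prod_const, Finset.card_univ, Fintype.card_fin, hphase, Real.exp_zero,
    mul_one, hconst, ← mul_pow]
  gcongr
  exact norm_dotForm_le j

theorem pow_two_pi_mul_norm_le {i N : ℕ} (hi : i ≤ N) (j : Zn n) :
    (2 * Real.pi * (n * ‖j‖)) ^ i ≤ (2 * Real.pi * (n + 1)) ^ N * (1 + ‖j‖) ^ N := by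
  have hbase : 2 * Real.pi * (n * ‖j‖) ≤ 2 * Real.pi * (n + 1) * (1 + ‖j‖) := by
    rw [← mul_assoc]
    gcongr <;> linarith
  have hone : 1 ≤ 2 * Real.pi * (n + 1) * (1 + ‖j‖) :=
    one_le_mul_of_one_le_of_one_le
      (one_le_mul_of_one_le_of_one_le (by linarith [Real.pi_gt_three]) (by simp)) (by simp)
  rw [← mul_pow]
  exact (pow_le_pow_left₀ (by positivity) hbase i).trans (pow_le_pow_right₀ hone hi)

theorem norm_iteratedFDeriv_le_tsum {c : Zn n → ℂ}
    (hc : ∀ l : ℕ, Summable fun j => (1 + ‖j‖) ^ l * ‖c j‖)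
    (hu : ∀ y, HasSum (fun j => c j * mFourier j y) (u y)) {i N : ℕ} (hi : i ≤ N)
    (x : Fin n → ℝ) :
    ‖iteratedFDeriv ℝ i (lift u) x‖ ≤
      (2 * Real.pi * (n + 1)) ^ N * ∑' j, (1 + ‖j‖) ^ N * ‖c j‖ := by
  set v : ℕ → Zn n → ℝ := fun l j => (2 * Real.pi * (n + 1)) ^ l * ((1 + ‖j‖) ^ l * ‖c j‖) with hv
  have hsum : ∀ l, Summable (v l) := fun l => (hc l).mul_left _
  have hterm : ∀ {l m : ℕ}, l ≤ m → ∀ (j : Zn n) (x : Fin n → ℝ),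
      ‖iteratedFDeriv ℝ l (c j • lift fun y => mFourier j y) x‖ ≤ v m j := fun {l m} hlm j x => by
    rw [iteratedFDeriv_const_smul_apply
      ((contDiff_lift_mFourier j).of_le (by exact_mod_cast le_top)).contDiffAt, norm_smul, mul_comm]
    simp only [hv, ← mul_assoc]
    gcongr
    exact (norm_iteratedFDeriv_lift_mFourier_le j l x).trans (pow_two_pi_mul_norm_le hlm j)
  have hseries : lift u = fun x => ∑' j, (c j • lift fun y => mFourier j y) x :=
    funext fun x => (hu (toTorus x)).tsum_eq.symm
  rw [hseries, iteratedFDeriv_tsum_apply (N := ⊤) (f := fun j => c j • lift fun y => mFourier j y)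
    (fun j => (contDiff_lift_mFourier j).const_smul (c j)) (fun l _ => hsum l)
    (fun l j x _ => hterm le_rfl j x) (by simp) x, ← tsum_mul_left]
  exact tsum_of_norm_bounded (hsum N).hasSum fun j => hterm hi j x

end TorusDerivative

section SchwartzFourier

open UnitAddTorus

variable {n : ℕ}

theorem exists_seminorm_le (Ψ : schwartzZT n) (N : ℕ) : ∃ B : ℝ, ∀ i ≤ N, ∀ k x,
    (1 + ‖k‖) ^ N * ‖iteratedFDeriv ℝ i (lift fun y => Ψ.1 (k, y)) x‖ ≤ B := by
  choose C hC using Ψ.2.2 N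
  refine ⟨∑ i ∈ Finset.range (N + 1), |C i|, fun i hi k x => ?_⟩
  calc _ ≤ |C i| := (hC i k x).trans (le_abs_self _)
    _ ≤ _ := Finset.single_le_sum (f := fun i => |C i|) (fun _ _ => abs_nonneg _)
        (Finset.mem_range.2 (by lia))

theorem continuous_schwartzZT_slice (Ψ : schwartzZT n) (k : Zn n) :
    Continuous fun y => Ψ.1 (k, y) :=
  continuous_lift_iff.1 (Ψ.2.1 k).continuous

/-- The Fourier coefficient `Ψ̂(k, j) = ∫ Ψ(k, y) e^{-2πi j·y} dy`, for `q = (k, j)`, as a linear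
functional of `Ψ`. -/
def fourierCoeffZT (q : Zn n × Zn n) : schwartzZT n →ₗ[ℂ] ℂ where
  toFun Ψ := mFourierCoeff (fun y => Ψ.1 (q.1, y)) q.2
  map_add' Ψ Θ := by
    have hint : ∀ Ψ : schwartzZT n,
        Integrable (fun y => mFourier (-q.2) y * Ψ.1 (q.1, y)) (torusMeasure n) := fun Ψ =>
      ((mFourier (-q.2)).continuous.mul
        (continuous_schwartzZT_slice Ψ q.1)).integrable_of_hasCompactSupport (.of_compactSpace _)
    simp only [mFourierCoeff_eq_integral_torusMeasure, ← integral_add (hint Ψ) (hint Θ), ← mul_add]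
    rfl
  map_smul' c Ψ := by
    simp only [mFourierCoeff_eq_integral_torusMeasure, RingHom.id_apply, ← integral_smul,
      ← mul_smul_comm]
    rfl

theorem fourierCoeffZT_apply (q : Zn n × Zn n) (Ψ : schwartzZT n) :
    fourierCoeffZT q Ψ = mFourierCoeff (fun y => Ψ.1 (q.1, y)) q.2 := rfl

theorem pow_mul_norm_fourierCoeffZT_le {N : ℕ} {Ψ : schwartzZT n} {B : ℝ}
    (hB : ∀ i ≤ N, ∀ k x,
      (1 + ‖k‖) ^ N * ‖iteratedFDeriv ℝ i (lift fun y => Ψ.1 (k, y)) x‖ ≤ B) (q : Zn n × Zn n) :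
    ((1 + ‖q.1‖) * (1 + ‖q.2‖)) ^ N * ‖fourierCoeffZT q Ψ‖ ≤ 2 ^ N * B := by
  have h := one_add_norm_pow_mul_norm_mFourierCoeff_le (N := N)
    ((Ψ.2.1 q.1).of_le (by exact_mod_cast le_top)) (B := B / (1 + ‖q.1‖) ^ N)
    (fun i hi x => (le_div_iff₀' (by positivity)).2 (hB i hi q.1 x)) q.2
  rwa [← mul_div_assoc, le_div_iff₀' (by positivity), ← mul_assoc, ← mul_pow] at h

theorem summable_pow_mul_norm_fourierCoeffZT (N : ℕ) (Ψ : schwartzZT n) :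
    Summable fun q : Zn n × Zn n =>
      ((1 + ‖q.1‖) * (1 + ‖q.2‖)) ^ N * ‖fourierCoeffZT q Ψ‖ := by
  obtain ⟨B, hB⟩ := exists_seminorm_le Ψ (N + 2 * n)
  have hn := summable_inv_one_add_norm_pow n
  refine ((hn.mul_of_nonneg hn (fun _ => by positivity) fun _ => by positivity).mul_left
    (2 ^ (N + 2 * n) * B)).of_nonneg_of_le (fun _ => by positivity) fun q => ?_
  rw [← mul_inv, ← mul_pow, ← div_eq_mul_inv, le_div_iff₀ (by positivity), mul_right_comm,
    ← pow_add]
  exact pow_mul_norm_fourierCoeffZT_le hB q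

theorem summable_norm_fourierCoeffZT (Ψ : schwartzZT n) :
    Summable fun q => ‖fourierCoeffZT q Ψ‖ := by
  simpa only [pow_zero, one_mul] using summable_pow_mul_norm_fourierCoeffZT 0 Ψ

theorem hasSum_fourierCoeffZT_mul_mFourier (Ψ : schwartzZT n) (k : Zn n) (y : Tn n) :
    HasSum (fun j => fourierCoeffZT (k, j) Ψ * mFourier j y) (Ψ.1 (k, y)) :=
  hasSum_mFourier_series_apply_of_summable
    (f := ⟨fun y => Ψ.1 (k, y), continuous_schwartzZT_slice Ψ k⟩)
    ((summable_norm_fourierCoeffZT Ψ).comp_injective (Prod.mk_right_injective k)).of_norm y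

theorem exists_fourierCoeffZT_ne_zero {Ψ : schwartzZT n} (h : Ψ ≠ 0) :
    ∃ q, fourierCoeffZT q Ψ ≠ 0 := by
  by_contra! hzero
  refine h (Subtype.ext (funext fun q => ?_))
  have hsum := hasSum_fourierCoeffZT_mul_mFourier Ψ q.1 q.2
  simp only [hzero, zero_mul] at hsum
  exact hsum.unique hasSum_zero

theorem seminorm_le_tsum_norm_fourierCoeffZT (Ψ : schwartzZT n) {i N : ℕ} (hi : i ≤ N) (k : Zn n)
    (x : Fin n → ℝ) :
    (1 + ‖k‖) ^ N * ‖iteratedFDeriv ℝ i (lift fun y => Ψ.1 (k, y)) x‖ ≤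
      (2 * Real.pi * (n + 1)) ^ N *
        ∑' q : Zn n × Zn n, ((1 + ‖q.1‖) * (1 + ‖q.2‖)) ^ N * ‖fourierCoeffZT q Ψ‖ := by
  set g : ℕ → Zn n × Zn n → ℝ := fun l q =>
    ((1 + ‖q.1‖) * (1 + ‖q.2‖)) ^ l * ‖fourierCoeffZT q Ψ‖
  have hg : ∀ l, Summable (g l) := fun l => summable_pow_mul_norm_fourierCoeffZT l Ψ
  have hweight : ∀ l, Summable fun j => (1 + ‖j‖) ^ l * ‖fourierCoeffZT (k, j) Ψ‖ := fun l => by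
    refine ((hg l).comp_injective (Prod.mk_right_injective k)).of_nonneg_of_le
      (fun _ => by positivity) fun j => ?_
    dsimp only [Function.comp, g]
    gcongr
    exact le_mul_of_one_le_left (by positivity) (by simp)
  calc _ ≤ (1 + ‖k‖) ^ N * ((2 * Real.pi * (n + 1)) ^ N *
          ∑' j, (1 + ‖j‖) ^ N * ‖fourierCoeffZT (k, j) Ψ‖) := by
        gcongr
        exact norm_iteratedFDeriv_le_tsum hweight (hasSum_fourierCoeffZT_mul_mFourier Ψ k) hi x
    _ = (2 * Real.pi * (n + 1)) ^ N *
          ∑' j, g N (k, j) := by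
        simp only [g, mul_pow, mul_assoc, tsum_mul_left, mul_left_comm]
    _ ≤ _ := by
        refine mul_le_mul_of_nonneg_left ?_ (by positivity)
        exact tsum_comp_le_tsum_of_inj (hg N)
          (fun _ => by positivity) (Prod.mk_right_injective k)

end SchwartzFourier

section Distribution

open UnitAddTorus

variable {n : ℕ}

/-- The function `δ_k ⊗ e_j` on `ℤⁿ × 𝕋ⁿ`, for `q = (k, j)`. -/
def basisFn (q : Zn n × Zn n) : schwartzZT n :=
  ⟨fun p => if p.1 = q.1 then mFourier q.2 p.2 else 0, by
    refine ⟨fun k => ?_, fun M i => ?_⟩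
    · by_cases hk : k = q.1 <;> simp only [hk, if_true, if_false]
      · exact contDiff_lift_mFourier q.2
      · exact contDiff_const
    · obtain ⟨C, hC, hbound⟩ := bound_lift_mFourier q.2 i
      refine ⟨(1 + ‖q.1‖) ^ M * C, fun k x => ?_⟩
      by_cases hk : k = q.1 <;> simp only [hk, if_true, if_false]
      · gcongr
        exact hbound x
      · have hzero : (lift fun _ => 0 : (Fin n → ℝ) → ℂ) = 0 := rfl
        rw [hzero, iteratedFDeriv_zero, Pi.zero_apply, norm_zero, mul_zero]
        positivity⟩

theorem basisFn_apply (q : Zn n × Zn n) (p : Zn n × Tn n) :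
    (basisFn q).1 p = if p.1 = q.1 then mFourier q.2 p.2 else 0 := rfl

theorem fourierCoeffZT_basisFn (p q : Zn n × Zn n) :
    fourierCoeffZT q (basisFn p) = if q = p then 1 else 0 := by
  simp only [fourierCoeffZT_apply, basisFn_apply]
  by_cases hfst : q.1 = p.1
  · simp only [hfst, if_true, mFourierCoeff_mFourier, Prod.ext_iff, true_and, eq_comm]
  · simp only [hfst, if_false, Prod.ext_iff, false_and, mFourierCoeff, smul_zero, integral_zero]

/-- The distribution `Ψ ↦ Ψ̂(q)`, which is given by the function `δ_k ⊗ e_{-j}` for `q = (k, j)`. -/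
def basisDist (q : Zn n × Zn n) : temperedZT n :=
  ⟨fourierCoeffZT q, 0, 1, zero_le_one, fun Ψ B hB => by
    simpa only [pow_zero, one_mul] using pow_mul_norm_fourierCoeffZT_le hB q⟩

theorem isGivenBy_basisDist (q : Zn n × Zn n) :
    IsGivenBy (basisDist q) (basisFn (q.1, -q.2)).1 := fun Ψ => by
  rw [tsum_eq_single q.1 fun m hm => by simp [basisFn_apply, hm]]
  simp only [basisFn_apply, if_true]
  rfl

/-- The coefficients `σ(δ_k ⊗ e_j)` of a tempered distribution on `ℤⁿ × 𝕋ⁿ`. -/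
def distCoeff : temperedZT n →ₗ[ℂ] Zn n × Zn n → ℂ where
  toFun σ q := σ.1 (basisFn q)
  map_add' _ _ := rfl
  map_smul' _ _ := rfl

theorem distCoeff_apply (σ : temperedZT n) (q : Zn n × Zn n) :
    distCoeff σ q = σ.1 (basisFn q) := rfl

theorem distCoeff_basisDist (p q : Zn n × Zn n) :
    distCoeff (basisDist p) q = if p = q then 1 else 0 :=
  fourierCoeffZT_basisFn q p

theorem fourierCoeffZT_sub_sum_smul_basisFn (Ψ : schwartzZT n) (F : Finset (Zn n × Zn n))
    (q : Zn n × Zn n) :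
    fourierCoeffZT q (Ψ - ∑ p ∈ F, fourierCoeffZT p Ψ • basisFn p) =
      (F : Set (Zn n × Zn n))ᶜ.indicator (fun q => fourierCoeffZT q Ψ) q := by
  classical
  simp only [map_sub, map_sum, map_smul, fourierCoeffZT_basisFn, smul_eq_mul, mul_ite, mul_one,
    mul_zero, Finset.sum_ite_eq, Set.indicator_apply, Set.mem_compl_iff, Finset.mem_coe]
  split_ifs <;> simp_all

theorem hasSum_fourierCoeffZT_mul_distCoeff (σ : temperedZT n) (Ψ : schwartzZT n) :
    HasSum (fun q => fourierCoeffZT q Ψ * distCoeff σ q) (σ.1 Ψ) := by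
  obtain ⟨N, C, _, hσ⟩ := σ.2
  set g : Zn n × Zn n → ℝ := fun q => ((1 + ‖q.1‖) * (1 + ‖q.2‖)) ^ N * ‖fourierCoeffZT q Ψ‖
  have hlim : Filter.Tendsto (fun F : Finset (Zn n × Zn n) =>
      C * ((2 * Real.pi * (n + 1)) ^ N * ∑' q : {q // q ∉ F}, g q)) Filter.atTop (nhds 0) := by
    simpa only [mul_zero] using
      ((tendsto_tsum_compl_atTop_zero g).const_mul ((2 * Real.pi * (n + 1)) ^ N)).const_mul C
  refine tendsto_iff_norm_sub_tendsto_zero.2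
    (squeeze_zero (fun _ => norm_nonneg _) (fun F => ?_) hlim)
  set R : schwartzZT n := Ψ - ∑ q ∈ F, fourierCoeffZT q Ψ • basisFn q with hR
  have htail : ∑' q : Zn n × Zn n, ((1 + ‖q.1‖) * (1 + ‖q.2‖)) ^ N * ‖fourierCoeffZT q R‖ =
      ∑' q : {q // q ∉ F}, g q := by
    refine Eq.trans (tsum_congr fun q => ?_) (tsum_subtype {q | q ∉ F} g).symm
    rw [fourierCoeffZT_sub_sum_smul_basisFn]
    by_cases hq : q ∈ F <;> simp [hq, g]
  calc ‖∑ q ∈ F, fourierCoeffZT q Ψ * distCoeff σ q - σ.1 Ψ‖ = ‖σ.1 R‖ := by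
        rw [norm_sub_rev, hR, map_sub, map_sum]
        simp only [map_smul, smul_eq_mul, distCoeff_apply]
    _ ≤ _ := (hσ R _ fun i hi k x => seminorm_le_tsum_norm_fourierCoeffZT R hi k x).trans_eq
        (by rw [htail])

theorem fourierCoeffZT_conjShift (Φ : schwartzZT n) (m : Zn n) (w x : Tn n) (ζ : Zn n)
    (q : Zn n × Zn n) :
    fourierCoeffZT q (conjShift Φ (m, w) (x, ζ)) =
      conj (fourierCoeffZT (q.1 - m, -(q.2 + ζ)) Φ) *
        (mFourier (-(q.2 + ζ)) w * mFourier (-q.1) x) := by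
  simp only [fourierCoeffZT_apply, mFourierCoeff_eq_integral_torusMeasure, conjShift, tfShiftZT,
    Prod.mk_sub_mk, neg_neg]
  rw [← integral_conj, ← integral_mul_const, ← integral_add_right_eq_self (μ := torusMeasure n) _ w]
  refine integral_congr_ae (.of_forall fun y => ?_)
  simp only [map_mul, ← mFourier_neg, mFourier_apply_add, add_sub_cancel_right, neg_add,
    mFourier_add]
  ring

theorem hasSum_stftZT (Φ : schwartzZT n) (σ : temperedZT n) (m : Zn n) (w x : Tn n) (ζ : Zn n) :
    HasSum (fun q => conj (fourierCoeffZT (q.1 - m, -(q.2 + ζ)) Φ) * distCoeff σ q *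
      (mFourier (-(q.2 + ζ)) w * mFourier (-q.1) x)) (stftZT Φ σ ((m, w), (x, ζ))) := by
  convert! hasSum_fourierCoeffZT_mul_distCoeff σ (conjShift Φ (m, w) (x, ζ)) using 2 with q
  rw [fourierCoeffZT_conjShift]
  ring

theorem measurable_stftZT (Φ : schwartzZT n) (σ : temperedZT n) : Measurable (stftZT Φ σ) := by
  have hseries : stftZT Φ σ = fun a => ∑' q : Zn n × Zn n,
      conj (fourierCoeffZT (q.1 - a.1.1, -(q.2 + a.2.2)) Φ) * distCoeff σ q *
        (mFourier (-(q.2 + a.2.2)) a.1.2 * mFourier (-q.1) a.2.1) :=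
    funext fun a => (hasSum_stftZT Φ σ a.1.1 a.1.2 a.2.1 a.2.2).tsum_eq.symm
  rw [hseries]
  refine Measurable.tsum fun q => ?_
  have hcoeff : Measurable fun p : Zn n × Zn n =>
      conj (fourierCoeffZT (q.1 - p.1, -(q.2 + p.2)) Φ) := .of_discrete
  have hlattice : Measurable fun a : (Zn n × Tn n) × (Tn n × Zn n) => (a.1.1, a.2.2) := by
    fun_prop
  have hfreq : Measurable fun a : (Zn n × Tn n) × (Tn n × Zn n) => -(q.2 + a.2.2) :=
    (Measurable.of_discrete (f := fun ζ : Zn n => -(q.2 + ζ))).comp (by fun_prop)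
  exact ((hcoeff.comp hlattice).mul_const _).mul ((measurable_mFourier_comp hfreq (by fun_prop)).mul
    (measurable_mFourier_comp measurable_const (by fun_prop)))

end Distribution

section Modulation

open UnitAddTorus

variable {n : ℕ}

theorem measurePreserving_phaseShuffle (n : ℕ) :
    MeasurePreserving
      (fun z : (Zn n × Zn n) × (Tn n × Tn n) => ((z.1.1, z.2.1), (z.2.2, z.1.2)))
      (Measure.count.prod ((torusMeasure n).prod (torusMeasure n))) (doublePhaseMeasure n) := by
  rw [← count_prod_count]
  exact ((MeasurePreserving.id _).prod Measure.measurePreserving_swap).comp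
    (measurePreserving_prodProdProdComm Measure.count Measure.count (torusMeasure n)
      (torusMeasure n))

theorem eLpNorm_stftZT (Φ : schwartzZT n) (σ : temperedZT n) (p : ℝ≥0∞) :
    eLpNorm (stftZT Φ σ) p (doublePhaseMeasure n) =
      eLpNorm (fun z : (Zn n × Zn n) × (Tn n × Tn n) => stftZT Φ σ ((z.1.1, z.2.1), (z.2.2, z.1.2)))
        p (Measure.count.prod ((torusMeasure n).prod (torusMeasure n))) :=
  (eLpNorm_comp_measurePreserving (measurable_stftZT Φ σ).aestronglyMeasurable
    (measurePreserving_phaseShuffle n)).symm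

theorem tsum_enorm_fourierCoeffZT_ne_top (Φ : schwartzZT n) :
    ∑' q, ‖fourierCoeffZT q Φ‖ₑ ≠ ⊤ := by
  simpa only [enorm_eq_nnnorm] using
    ENNReal.tsum_coe_ne_top_iff_summable_coe.2 (summable_norm_fourierCoeffZT Φ)

theorem enorm_stftZT_le (Φ : schwartzZT n) (σ : temperedZT n) (m ζ : Zn n) (w x : Tn n) :
    ‖stftZT Φ σ ((m, w), (x, ζ))‖ₑ ≤
      ∑' q : Zn n × Zn n, ‖fourierCoeffZT (q.1 - m, -(q.2 + ζ)) Φ‖ₑ * ‖distCoeff σ q‖ₑ := by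
  rw [← (hasSum_stftZT Φ σ m w x ζ).tsum_eq]
  refine enorm_tsum_le_tsum_enorm.trans_eq (tsum_congr fun q => ?_)
  simp only [enorm_mul, RCLike.enorm_conj, enorm_mFourier_apply, mul_one]

theorem eLpNorm_stftZT_le (Φ : schwartzZT n) (σ : temperedZT n) {p : ℝ≥0∞} (hp : 1 ≤ p) :
    eLpNorm (stftZT Φ σ) p (doublePhaseMeasure n) ≤
      (∑' q, ‖fourierCoeffZT q Φ‖ₑ) * eLpNorm (distCoeff σ) p .count := by
  rw [eLpNorm_stftZT]
  refine (eLpNorm_prod_le_of_enorm_le .of_discrete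
    (fun z y => enorm_stftZT_le Φ σ z.1 z.2 y.1 y.2) p).trans
      (eLpNorm_tsum_mul_le (fun z => ?_) (fun q => ?_) _ hp)
  · refine ENNReal.tsum_comp_le_tsum_of_injective
      (f := fun q : Zn n × Zn n => (q.1 - z.1, -(q.2 + z.2))) (fun q q' h => ?_)
      fun q => ‖fourierCoeffZT q Φ‖ₑ
    simpa [Prod.ext_iff] using h
  · refine ENNReal.tsum_comp_le_tsum_of_injective
      (f := fun z : Zn n × Zn n => (q.1 - z.1, -(q.2 + z.2))) (fun z z' h => ?_)
      fun q => ‖fourierCoeffZT q Φ‖ₑ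
    simpa [Prod.ext_iff] using h

theorem enorm_mul_enorm_distCoeff_le_lintegral (Φ : schwartzZT n) (σ : temperedZT n)
    (q₀ q : Zn n × Zn n) :
    ‖fourierCoeffZT q₀ Φ‖ₑ * ‖distCoeff σ q‖ₑ ≤
      ∫⁻ y : Tn n × Tn n, ‖stftZT Φ σ ((q.1 - q₀.1, y.1), (y.2, -q.2 - q₀.2))‖ₑ
        ∂(torusMeasure n).prod (torusMeasure n) := by
  set m := q.1 - q₀.1 with hm
  set ζ := -q.2 - q₀.2 with hζ
  set c : Zn n × Zn n → ℂ := fun l =>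
    conj (fourierCoeffZT (l.1 - m, -(l.2 + ζ)) Φ) * distCoeff σ l with hc
  have hinj : Function.Injective fun l : Zn n × Zn n => (-(l.2 + ζ), -l.1) := fun l l' h => by
    simpa [Prod.ext_iff, and_comm] using h
  have hsystem :=
    ((isUnimodularSystem_mFourier n).prod (isUnimodularSystem_mFourier n)).comp_injective hinj
  have hsummable : Summable c := by
    refine Summable.of_norm ((hasSum_stftZT Φ σ m 0 0 ζ).summable.norm.congr fun l => ?_)
    simp only [norm_mul, norm_mFourier_apply, mul_one, hc]
  have hcoeff : ‖c q‖ₑ = ‖fourierCoeffZT q₀ Φ‖ₑ * ‖distCoeff σ q‖ₑ := by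
    have harg : (q.1 - m, -(q.2 + ζ)) = q₀ := by ext <;> simp [hm, hζ]
    simp only [hc, harg, enorm_mul, RCLike.enorm_conj]
  rw [← hcoeff]
  refine (hsystem.enorm_coeff_le_lintegral hsummable q).trans_eq (lintegral_congr fun y => ?_)
  rw [(hasSum_stftZT Φ σ m y.1 y.2 ζ).tsum_eq]

theorem enorm_mul_eLpNorm_distCoeff_le (Φ : schwartzZT n) (σ : temperedZT n) (q₀ : Zn n × Zn n)
    {p : ℝ≥0∞} (hp : 1 ≤ p) :
    ‖fourierCoeffZT q₀ Φ‖ₑ * eLpNorm (distCoeff σ) p .count ≤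
      eLpNorm (stftZT Φ σ) p (doublePhaseMeasure n) := by
  rw [eLpNorm_stftZT, ← eLpNorm_const_smul]
  have hmeas := ((measurable_stftZT Φ σ).comp
    (measurePreserving_phaseShuffle n).measurable).aestronglyMeasurable
      (μ := Measure.count.prod ((torusMeasure n).prod (torusMeasure n)))
  refine eLpNorm_count_le_eLpNorm_prod (e := fun q => (q.1 - q₀.1, -q.2 - q₀.2)) hmeas
    (fun q q' h => by simpa [Prod.ext_iff] using h) (fun q => ?_) hp
  rw [Pi.smul_apply, smul_eq_mul, enorm_mul]
  exact enorm_mul_enorm_distCoeff_le_lintegral Φ σ q₀ q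

theorem eLpNorm_distCoeff_ne_top {Φ : schwartzZT n} (hΦ : Φ ≠ 0) {p : ℝ≥0∞} (hp : 1 ≤ p)
    (σ : modZT Φ p) : eLpNorm (distCoeff σ.1) p .count ≠ ⊤ := fun htop => by
  obtain ⟨q₀, hq₀⟩ := exists_fourierCoeffZT_ne_zero hΦ
  have h := (enorm_mul_eLpNorm_distCoeff_le Φ σ.1 q₀ hp).trans_lt σ.2.2
  rw [htop, ENNReal.mul_top (enorm_ne_zero.2 hq₀)] at h
  exact h.ne rfl

theorem norm_distCoeff_le {Φ : schwartzZT n} {q₀ : Zn n × Zn n} (hq₀ : fourierCoeffZT q₀ Φ ≠ 0)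
    {p : ℝ≥0∞} (hp : 1 ≤ p) (σ : modZT Φ p) (q : Zn n × Zn n) :
    ‖distCoeff σ.1 q‖ ≤ ‖fourierCoeffZT q₀ Φ‖⁻¹ * modNormZT Φ p σ.1 := by
  have h : ‖fourierCoeffZT q₀ Φ‖ₑ * ‖distCoeff σ.1 q‖ₑ ≤
      eLpNorm (stftZT Φ σ.1) p (doublePhaseMeasure n) :=
    (mul_le_mul_right (enorm_le_eLpNorm_count _ q (zero_lt_one.trans_le hp).ne') _).trans
      (enorm_mul_eLpNorm_distCoeff_le Φ σ.1 q₀ hp)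
  have hreal := ENNReal.toReal_mono σ.2.2.ne h
  rw [ENNReal.toReal_mul, toReal_enorm, toReal_enorm] at hreal
  rwa [← div_eq_inv_mul, le_div_iff₀' (norm_pos_iff.2 hq₀)]

theorem mem_modZT_of_eLpNorm_distCoeff_ne_top (Φ : schwartzZT n) {σ : temperedZT n} {p : ℝ≥0∞}
    (hp : 1 ≤ p) (hσ : eLpNorm (distCoeff σ) p .count ≠ ⊤) : σ ∈ modZT Φ p :=
  ⟨(measurable_stftZT Φ σ).aestronglyMeasurable, (eLpNorm_stftZT_le Φ σ hp).trans_lt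
    (ENNReal.mul_lt_top (tsum_enorm_fourierCoeffZT_ne_top Φ).lt_top hσ.lt_top)⟩

end Modulation

section ModulationLattice

open UnitAddTorus

variable {n : ℕ} {φ g : Zn n → ℂ}

theorem summable_mul_conj_of_isTempered (hg : IsTempered g) (hφ : IsSchwartz φ) (m : Zn n) :
    Summable fun k => g k * conj (φ (k - m)) := by
  obtain ⟨M, C, hC⟩ := hg
  obtain ⟨D, hD⟩ := hφ (M + 2 * n)
  have hC0 : 0 ≤ C := by simpa using (norm_nonneg _).trans (hC 0)
  have hsum := ((summable_inv_one_add_norm_pow n).comp_injective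
    (sub_left_injective (b := m))).mul_left (C * (1 + ‖m‖) ^ M * D)
  refine .of_norm (hsum.of_nonneg_of_le (fun _ => norm_nonneg _) fun k => ?_)
  have hk : 1 + ‖k‖ ≤ (1 + ‖m‖) * (1 + ‖k - m‖) := by
    have : ‖k‖ ≤ ‖k - m‖ + ‖m‖ := by simpa using norm_add_le (k - m) m
    nlinarith [norm_nonneg m, norm_nonneg (k - m)]
  rw [norm_mul, RCLike.norm_conj, Function.comp_apply, ← div_eq_mul_inv,
    le_div_iff₀ (by positivity)]
  calc ‖g k‖ * ‖φ (k - m)‖ * (1 + ‖k - m‖) ^ (2 * n)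
      ≤ C * ((1 + ‖m‖) * (1 + ‖k - m‖)) ^ M * ‖φ (k - m)‖ * (1 + ‖k - m‖) ^ (2 * n) := by
        gcongr
        exact (hC k).trans (by gcongr)
    _ = C * (1 + ‖m‖) ^ M * ((1 + ‖k - m‖) ^ (M + 2 * n) * ‖φ (k - m)‖) := by
        rw [mul_pow]
        ring
    _ ≤ C * (1 + ‖m‖) ^ M * D := by
        gcongr
        exact hD (k - m)

theorem stft_eq_tsum_mul_mFourier (φ g : Zn n → ℂ) (m : Zn n) (w : Tn n) :
    stft φ g (m, w) = ∑' k, g k * conj (φ (k - m)) * mFourier (-k) w :=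
  tsum_congr fun k => by rw [tfShift, map_mul, mFourier_neg, mul_assoc, mul_comm (conj (φ _))]

theorem enorm_mul_enorm_le_lintegral_stft (hφ : IsSchwartz φ) (hg : IsTempered g) (j k : Zn n) :
    ‖φ j‖ₑ * ‖g k‖ₑ ≤ ∫⁻ w, ‖stft φ g (k - j, w)‖ₑ ∂torusMeasure n := by
  have h := ((isUnimodularSystem_mFourier n).comp_injective neg_injective).enorm_coeff_le_lintegral
    (summable_mul_conj_of_isTempered hg hφ (k - j)) k
  rw [sub_sub_cancel, enorm_mul, RCLike.enorm_conj, mul_comm] at h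
  simpa only [stft_eq_tsum_mul_mFourier] using h

variable {p : ℝ≥0∞}

theorem enorm_mul_eLpNorm_le_eLpNorm_stft (hφ : IsSchwartz φ) (hg : MemMod φ p g) (hp : 1 ≤ p)
    (j : Zn n) :
    ‖φ j‖ₑ * eLpNorm g p .count ≤ eLpNorm (stft φ g) p (phaseMeasure n) := by
  rw [← eLpNorm_const_smul]
  refine eLpNorm_count_le_eLpNorm_prod (e := fun k => k - j) hg.2.1 sub_left_injective
    (fun k => ?_) hp
  rw [Pi.smul_apply, smul_eq_mul, enorm_mul]
  exact enorm_mul_enorm_le_lintegral_stft hφ hg.1 j k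

theorem MemMod.memLp_count (hg : MemMod φ p g) (hφ : IsSchwartz φ) (h0 : φ ≠ 0) (hp : 1 ≤ p) :
    MemLp g p .count := by
  obtain ⟨j, hj⟩ := Function.ne_iff.1 h0
  have h := (enorm_mul_eLpNorm_le_eLpNorm_stft hφ hg hp j).trans_lt hg.2.2
  exact ⟨.of_discrete, ENNReal.lt_top_of_mul_ne_top_right h.ne (enorm_ne_zero.2 hj)⟩

theorem MemMod.norm_mul_eLpNorm_le (hg : MemMod φ p g) (hφ : IsSchwartz φ) (hp : 1 ≤ p)
    (j : Zn n) : ‖φ j‖ * (eLpNorm g p .count).toReal ≤ modNorm φ p g := by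
  have h := ENNReal.toReal_mono hg.2.2.ne (enorm_mul_eLpNorm_le_eLpNorm_stft hφ hg hp j)
  rwa [ENNReal.toReal_mul, toReal_enorm] at h

theorem toReal_eLpNorm_one_count {ι : Type*} [MeasurableSpace ι] [MeasurableSingletonClass ι]
    (f : ι → ℂ) : (eLpNorm f 1 .count).toReal = ∑' i, ‖f i‖ := by
  rw [eLpNorm_one_eq_lintegral_enorm, lintegral_count,
    ENNReal.tsum_toReal_eq fun _ => enorm_ne_top]
  simp only [toReal_enorm]

theorem MemMod.summable (hg : MemMod φ 1 g) (hφ : IsSchwartz φ) (h0 : φ ≠ 0) : Summable g :=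
  summable_norm_iff.1 (integrable_count_iff.1
    (memLp_one_iff_integrable.1 (hg.memLp_count hφ h0 le_rfl)))

theorem MemMod.tsum_norm_le (hg : MemMod φ 1 g) (hφ : IsSchwartz φ) {j : Zn n} (hj : φ j ≠ 0) :
    ∑' k, ‖g k‖ ≤ ‖φ j‖⁻¹ * modNorm φ 1 g := by
  rw [← div_eq_inv_mul, le_div_iff₀' (norm_pos_iff.2 hj), ← toReal_eLpNorm_one_count]
  exact hg.norm_mul_eLpNorm_le hφ le_rfl j

end ModulationLattice

section WeightedShift

theorem memℓp_comp_of_injective {ι κ E : Type*} [NormedAddCommGroup E] {p : ℝ≥0∞} {f : κ → E}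
    (hf : Memℓp f p) {e : ι → κ} (he : Function.Injective e) : Memℓp (fun i => f (e i)) p := by
  obtain rfl | rfl | hp := p.trichotomy
  · rw [memℓp_zero_iff] at hf ⊢
    exact hf.preimage he.injOn
  · rw [memℓp_infty_iff] at hf ⊢
    exact hf.mono (Set.range_comp_subset_range e fun k => ‖f k‖)
  · rw [memℓp_gen_iff hp] at hf ⊢
    exact hf.comp_injective he

variable {ι κ E : Type*} [NormedAddCommGroup E] [NormedSpace ℂ E]
variable (p : ℝ≥0∞) [Fact (1 ≤ p)]

/-- Composition with an injective map, as a linear map between `ℓ^p` spaces. -/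
def lpCompₗ (e : ι → κ) (he : Function.Injective e) :
    lp (fun _ : κ => E) p →ₗ[ℂ] lp (fun _ : ι => E) p where
  toFun f := ⟨fun i => f (e i), memℓp_comp_of_injective (lp.memℓp f) he⟩
  map_add' _ _ := rfl
  map_smul' _ _ := rfl

theorem norm_lpCompₗ_apply_le (e : ι → κ) (he : Function.Injective e) (f : lp (fun _ : κ => E) p) :
    ‖lpCompₗ p e he f‖ ≤ ‖f‖ := by
  obtain rfl | hp := p.dichotomy
  · exact lp.norm_le_of_forall_le (norm_nonneg f) fun i => lp.norm_apply_le_norm (by simp) f _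
  · have hp0 : 0 < p.toReal := zero_lt_one.trans_le hp
    refine lp.norm_le_of_tsum_le hp0 (norm_nonneg f) ?_
    rw [lp.norm_rpow_eq_tsum hp0]
    exact tsum_comp_le_tsum_of_inj ((lp.memℓp f).summable hp0) (fun _ => by positivity) he

/-- The continuous linear map underlying `lpCompₗ`. -/
def lpComp (e : ι → κ) (he : Function.Injective e) :
    lp (fun _ : κ => E) p →L[ℂ] lp (fun _ : ι => E) p :=
  (lpCompₗ p e he).mkContinuous 1 fun f => by
    rw [one_mul]
    exact norm_lpCompₗ_apply_le p e he f

theorem norm_lpComp_le (e : ι → κ) (he : Function.Injective e) :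
    ‖lpComp (E := E) p e he‖ ≤ 1 :=
  LinearMap.mkContinuous_norm_le _ zero_le_one _

/-- Multiplication by a bounded function on an `ℓ^p` space. -/
def lpMul (a : lp (fun _ : ι => ℂ) ⊤) : lp (fun _ : ι => ℂ) p →L[ℂ] lp (fun _ : ι => ℂ) p :=
  lp.mapCLM p (fun i => ContinuousLinearMap.mul ℂ ℂ (a i)) (norm_nonneg a) fun i =>
    (ContinuousLinearMap.opNorm_mul_apply_le ℂ ℂ _).trans (lp.norm_apply_le_norm (by simp) a i)

theorem norm_lpMul_le (a : lp (fun _ : ι => ℂ) ⊤) : ‖lpMul p a‖ ≤ ‖a‖ :=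
  lp.norm_mapCLM_le p _ _ _

variable {G : Type*} [AddCommGroup G]

/-- The localization operator whose windows are the unit vectors at `z.1` and `z.2`, for a symbol
with Fourier coefficients `a`: it maps `f` to `k ↦ a (k - z.2, z.2 - z.1) * f (k + (z.1 - z.2))`. -/
def weightedShift (a : lp (fun _ : G × G => ℂ) ⊤) (z : G × G) :
    lp (fun _ : G => ℂ) p →L[ℂ] lp (fun _ : G => ℂ) p :=
  lpMul p (lpComp ⊤ (fun k => (k - z.2, z.2 - z.1))
      ((Prod.mk_left_injective _).comp sub_left_injective) a) ∘L
    lpComp p (fun k => k + (z.1 - z.2)) (add_left_injective _)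

theorem weightedShift_apply (a : lp (fun _ : G × G => ℂ) ⊤) (z : G × G) (f : lp (fun _ : G => ℂ) p)
    (k : G) : weightedShift p a z f k = a (k - z.2, z.2 - z.1) * f (k + (z.1 - z.2)) :=
  rfl

theorem norm_weightedShift_le (a : lp (fun _ : G × G => ℂ) ⊤) (z : G × G) :
    ‖weightedShift p a z‖ ≤ ‖a‖ := by
  refine (ContinuousLinearMap.opNorm_comp_le _ _).trans
    ((mul_le_of_le_one_right (norm_nonneg _) (norm_lpComp_le _ _ _)).trans ?_)
  exact (norm_lpMul_le p _).trans (norm_lpCompₗ_apply_le ⊤ _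
    ((Prod.mk_left_injective _).comp sub_left_injective) a)

/-- The localization operator with windows `g₁` and `g₂`, for a symbol with Fourier coefficients
`a`. -/
def coeffLocOp (g₁ g₂ : G → ℂ) (a : lp (fun _ : G × G => ℂ) ⊤) :
    lp (fun _ : G => ℂ) p →L[ℂ] lp (fun _ : G => ℂ) p :=
  ∑' z : G × G, (conj (g₁ z.1) * g₂ z.2) • weightedShift p a z

theorem norm_smul_weightedShift_le (g₁ g₂ : G → ℂ) (a : lp (fun _ : G × G => ℂ) ⊤) (z : G × G) :
    ‖(conj (g₁ z.1) * g₂ z.2) • weightedShift p a z‖ ≤ ‖g₁ z.1‖ * ‖g₂ z.2‖ * ‖a‖ := by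
  rw [norm_smul, norm_mul, RCLike.norm_conj]
  gcongr
  exact norm_weightedShift_le p a z

variable {g₁ g₂ : G → ℂ} (h₁ : Summable g₁) (h₂ : Summable g₂)
  (a : lp (fun _ : G × G => ℂ) ⊤)

include h₁ h₂

theorem norm_coeffLocOp_le :
    ‖coeffLocOp p g₁ g₂ a‖ ≤ (∑' k, ‖g₁ k‖) * (∑' k, ‖g₂ k‖) * ‖a‖ := by
  rw [tsum_mul_tsum_of_summable_norm h₁.norm.norm h₂.norm.norm, ← tsum_mul_right]
  exact tsum_of_norm_bounded ((h₁.norm.mul_of_nonneg h₂.norm (fun _ => norm_nonneg _)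
    fun _ => norm_nonneg _).mul_right ‖a‖).hasSum (norm_smul_weightedShift_le p g₁ g₂ a)

theorem hasSum_coeffLocOp_apply (f : lp (fun _ : G => ℂ) p) (k : G) :
    HasSum (fun z : G × G => conj (g₁ z.1) * g₂ z.2 *
      (a (k - z.2, z.2 - z.1) * f (k + (z.1 - z.2)))) (coeffLocOp p g₁ g₂ a f k) := by
  have hsum : Summable fun z : G × G => (conj (g₁ z.1) * g₂ z.2) • weightedShift p a z :=
    .of_norm_bounded ((h₁.norm.mul_of_nonneg h₂.norm (fun _ => norm_nonneg _)
      fun _ => norm_nonneg _).mul_right ‖a‖) (norm_smul_weightedShift_le p g₁ g₂ a)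
  have h := (lp.evalCLM ℂ (fun _ : G => ℂ) p k).hasSum
    ((ContinuousLinearMap.apply ℂ _ f).hasSum hsum.hasSum)
  refine h.congr_fun fun z => ?_
  rw [← weightedShift_apply]
  rfl

/-- The map from the Fourier coefficients of the symbol to the localization operator, for summable
windows. -/
def coeffLocOpₗ : lp (fun _ : G × G => ℂ) ⊤ →ₗ[ℂ]
    lp (fun _ : G => ℂ) p →L[ℂ] lp (fun _ : G => ℂ) p where
  toFun := coeffLocOp p g₁ g₂
  map_add' a b := by
    ext f k
    refine (hasSum_coeffLocOp_apply p h₁ h₂ (a + b) f k).unique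
      (((hasSum_coeffLocOp_apply p h₁ h₂ a f k).add
        (hasSum_coeffLocOp_apply p h₁ h₂ b f k)).congr_fun fun z => ?_)
    rw [lp.coeFn_add, Pi.add_apply, add_mul, mul_add]
  map_smul' c a := by
    ext f k
    refine (hasSum_coeffLocOp_apply p h₁ h₂ (c • a) f k).unique
      (((hasSum_coeffLocOp_apply p h₁ h₂ a f k).mul_left c).congr_fun fun z => ?_)
    rw [lp.coeFn_smul, Pi.smul_apply, smul_eq_mul, mul_assoc c, mul_left_comm _ c]

end WeightedShift

section Agreement

open UnitAddTorus

variable {n : ℕ}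

theorem integrable_slice {s : Zn n × Tn n → ℂ} {p : ℝ≥0∞} (hp : 1 ≤ p)
    (hs : MemLp s p (phaseMeasure n)) (m : Zn n) :
    Integrable (fun w => s (m, w)) (torusMeasure n) := by
  have hmeas : ∀ m, AEStronglyMeasurable (fun w => s (m, w)) (torusMeasure n) := by
    simpa only [Measure.ae_count_iff] using hs.1.prodMk_left
  refine ⟨hmeas m, ?_⟩
  calc ∫⁻ w, ‖s (m, w)‖ₑ ∂torusMeasure n
      = ‖∫⁻ w, ‖s (m, w)‖ₑ ∂torusMeasure n‖ₑ := (enorm_eq_self _).symm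
    _ ≤ eLpNorm (fun m => ∫⁻ w, ‖s (m, w)‖ₑ ∂torusMeasure n) p .count :=
        enorm_le_eLpNorm_count _ m (by positivity)
    _ ≤ eLpNorm s p (phaseMeasure n) := eLpNorm_lintegral_enorm_le hs.1 hp
    _ < ⊤ := hs.2

theorem distCoeff_of_isGivenBy {σ : temperedZT n} {s : Zn n × Tn n → ℂ} (h : IsGivenBy σ s)
    (q : Zn n × Zn n) :
    distCoeff σ q = ∫ w, s (q.1, w) * mFourier q.2 w ∂torusMeasure n := by
  rw [distCoeff_apply, h, tsum_eq_single q.1]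
  · simp only [basisFn_apply, if_true]
  · intro m hm
    simp only [basisFn_apply, hm, if_false, mul_zero, integral_zero]

theorem hasSum_integral_mul_stft {g₁ g₂ : Zn n → ℂ} (h₁ : Summable g₁) {u : Tn n → ℂ}
    (hu : Integrable u (torusMeasure n)) (f : ell2 n) (m k : Zn n) :
    HasSum (fun l => conj (g₁ (l - m)) * g₂ (k - m) *
      ((∫ w, u w * mFourier (k - l) w ∂torusMeasure n) * f l))
      (∫ w, u w * stft g₁ f (m, w) * tfShift (m, w) g₂ k ∂torusMeasure n) := by
  have hf : Summable fun l => f l * conj (g₁ (l - m)) := by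
    refine .of_norm_bounded ((h₁.norm.comp_injective (sub_left_injective (b := m))).mul_left ‖f‖)
      fun l => ?_
    rw [norm_mul, RCLike.norm_conj]
    exact mul_le_mul_of_nonneg_right (lp.norm_apply_le_norm two_ne_zero f l) (norm_nonneg _)
  have hχ := (isUnimodularSystem_mFourier n).comp_injective neg_injective
  have hsum := (hasSum_mul_integral_mul (u := fun w => u w * mFourier k w)
    (hu.mul_bdd (c := 1) (mFourier k).continuous.aestronglyMeasurable
      (.of_forall fun w => (norm_mFourier_apply k w).le)) hf hχ.aestronglyMeasurable
    fun l w => (hχ.norm_eq_one l w).le).mul_right (g₂ (k - m))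
  have heq : ∀ w, u w * mFourier k w * (∑' l, f l * conj (g₁ (l - m)) * mFourier (-l) w) *
      g₂ (k - m) = u w * stft g₁ f (m, w) * tfShift (m, w) g₂ k := fun w => by
    rw [stft_eq_tsum_mul_mFourier, tfShift]
    ring
  simp only [← integral_mul_const, heq] at hsum
  refine hsum.congr_fun fun l => ?_
  simp only [sub_eq_add_neg k l, mFourier_add, mul_assoc]
  ring

theorem eq_locOp_of_hasSum {g₁ g₂ : Zn n → ℂ} (h₁ : Summable g₁) {σ : temperedZT n}
    {s : Zn n × Tn n → ℂ} (hs : ∀ m, Integrable (fun w => s (m, w)) (torusMeasure n))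
    (hσ : IsGivenBy σ s) (f : ell2 n) (k : Zn n) {c : ℂ}
    (hc : HasSum (fun z : Zn n × Zn n => conj (g₁ z.1) * g₂ z.2 *
      (distCoeff σ (k - z.2, z.2 - z.1) * f (k + (z.1 - z.2)))) c) :
    c = locOp g₁ g₂ s f k := by
  let e : Zn n × Zn n ≃ Zn n × Zn n :=
    { toFun := fun q => (q.2 - q.1, k - q.1)
      invFun := fun z => (k - z.2, k + (z.1 - z.2))
      left_inv := fun q => by ext1 <;> simp
      right_inv := fun z => by ext1 <;> simp }
  refine ((e.hasSum_iff.2 hc).prod_fiberwise fun m => ?_).tsum_eq.symm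
  refine (hasSum_integral_mul_stft h₁ (hs m) f m k).congr_fun fun l => ?_
  simp [e, distCoeff_of_isGivenBy hσ]

end Agreement

section Extension

variable {n : ℕ} {φ : Zn n → ℂ} {Φ : schwartzZT n} {p : ℝ≥0∞} {q₀ : Zn n × Zn n}

/-- The Fourier coefficients of the elements of `M^p(ℤⁿ × 𝕋ⁿ)`, as bounded functions. -/
def distCoeffLp (hq₀ : fourierCoeffZT q₀ Φ ≠ 0) (hp : 1 ≤ p) :
    modZT Φ p →ₗ[ℂ] lp (fun _ : Zn n × Zn n => ℂ) ⊤ where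
  toFun σ := ⟨distCoeff σ.1, memℓp_infty ⟨_, Set.forall_mem_range.2 (norm_distCoeff_le hq₀ hp σ)⟩⟩
  map_add' σ τ := Subtype.ext (map_add distCoeff σ.1 τ.1)
  map_smul' c σ := Subtype.ext (map_smul distCoeff c σ.1)

theorem norm_distCoeffLp_le (hq₀ : fourierCoeffZT q₀ Φ ≠ 0) (hp : 1 ≤ p) (σ : modZT Φ p) :
    ‖distCoeffLp hq₀ hp σ‖ ≤ ‖fourierCoeffZT q₀ Φ‖⁻¹ * modNormZT Φ p σ.1 :=
  lp.norm_le_of_forall_le ((norm_nonneg _).trans (norm_distCoeff_le hq₀ hp σ 0))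
    (norm_distCoeff_le hq₀ hp σ)

/-- The extension of the localization operators `L_σ^{g₁,g₂}` to all symbols `σ` in
`M^p(ℤⁿ × 𝕋ⁿ)`. -/
def extendedLocOp (hq₀ : fourierCoeffZT q₀ Φ ≠ 0) (hp : 1 ≤ p) {g₁ g₂ : Zn n → ℂ}
    (h₁ : Summable g₁) (h₂ : Summable g₂) : modZT Φ p →ₗ[ℂ] (ell2 n →L[ℂ] ell2 n) :=
  coeffLocOpₗ 2 h₁ h₂ ∘ₗ distCoeffLp hq₀ hp

theorem extendsLocOp_extendedLocOp (hq₀ : fourierCoeffZT q₀ Φ ≠ 0) (hp : 1 ≤ p)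
    {g₁ g₂ : Zn n → ℂ} (h₁ : Summable g₁) (h₂ : Summable g₂) :
    ExtendsLocOp g₁ g₂ (extendedLocOp hq₀ hp h₁ h₂) Set.univ := fun σ _ _ hs hσ f k =>
  eq_locOp_of_hasSum h₁ (hs.elim (integrable_slice le_rfl) (integrable_slice le_top)) hσ f k
    (hasSum_coeffLocOp_apply 2 h₁ h₂ (distCoeffLp hq₀ hp σ) f k)

theorem norm_extendedLocOp_le (hφ : IsSchwartz φ) {j : Zn n} (hj : φ j ≠ 0)
    (hq₀ : fourierCoeffZT q₀ Φ ≠ 0) (hp : 1 ≤ p) {g₁ g₂ : Zn n → ℂ} (hg₁ : MemMod φ 1 g₁)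
    (hg₂ : MemMod φ 1 g₂) (h₁ : Summable g₁) (h₂ : Summable g₂) (σ : modZT Φ p) :
    ‖extendedLocOp hq₀ hp h₁ h₂ σ‖ ≤ ‖fourierCoeffZT q₀ Φ‖⁻¹ * ‖φ j‖⁻¹ * ‖φ j‖⁻¹ *
      modNormZT Φ p σ.1 * modNorm φ 1 g₁ * modNorm φ 1 g₂ := by
  have hmod {g : Zn n → ℂ} (hg : MemMod φ 1 g) : 0 ≤ ‖φ j‖⁻¹ * modNorm φ 1 g :=
    (tsum_nonneg fun _ => norm_nonneg _).trans (hg.tsum_norm_le hφ hj)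
  calc ‖extendedLocOp hq₀ hp h₁ h₂ σ‖
      ≤ (∑' k, ‖g₁ k‖) * (∑' k, ‖g₂ k‖) * ‖distCoeffLp hq₀ hp σ‖ :=
        norm_coeffLocOp_le 2 h₁ h₂ (distCoeffLp hq₀ hp σ)
    _ ≤ (‖φ j‖⁻¹ * modNorm φ 1 g₁) * (‖φ j‖⁻¹ * modNorm φ 1 g₂) *
          (‖fourierCoeffZT q₀ Φ‖⁻¹ * modNormZT Φ p σ.1) := by
        gcongr
        · exact mul_nonneg (hmod hg₁) (hmod hg₂)
        · exact hmod hg₁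
        · exact hg₁.tsum_norm_le hφ hj
        · exact hg₂.tsum_norm_le hφ hj
        · exact norm_distCoeffLp_le hq₀ hp σ
    _ = _ := by ring

end Extension

section BasisFunctions

variable {n : ℕ}

theorem isSchwartz_single (j : Zn n) (c : ℂ) : IsSchwartz (Pi.single j c) := by
  intro M
  refine ⟨(1 + ‖j‖) ^ M * ‖c‖, fun k => ?_⟩
  obtain rfl | h := eq_or_ne k j
  · rw [Pi.single_eq_same]
  · rw [Pi.single_eq_of_ne h, norm_zero, mul_zero]
    positivity

theorem eLpNorm_basisFn (q : Zn n × Zn n) {p : ℝ≥0∞} (h0 : p ≠ 0) :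
    eLpNorm (basisFn q).1 p (phaseMeasure n) = 1 := by
  have hms : MeasurableSet (Prod.fst ⁻¹' {q.1} : Set (Zn n × Tn n)) :=
    measurable_fst (measurableSet_singleton q.1)
  have hμs : phaseMeasure n (Prod.fst ⁻¹' {q.1}) = 1 := by
    rw [phaseMeasure, measurePreserving_fst.measure_preimage
      (measurableSet_singleton q.1).nullMeasurableSet, Measure.count_singleton]
  have hnorm (a : Zn n × Tn n) :
      ‖(basisFn q).1 a‖ = ‖(Prod.fst ⁻¹' {q.1}).indicator (fun _ => (1 : ℝ)) a‖ := by
    rw [basisFn_apply]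
    by_cases h : a.1 = q.1 <;> simp [h, norm_mFourier_apply]
  rw [eLpNorm_congr_norm_ae (.of_forall hnorm),
    eLpNorm_indicator_const' hms (hμs.trans_ne one_ne_zero) h0, hμs, ENNReal.one_rpow, mul_one,
    enorm_one]

theorem memLp_basisFn (q : Zn n × Zn n) (p : ℝ≥0∞) : MemLp (basisFn q).1 p (phaseMeasure n) := by
  refine ⟨(measurable_from_prod_countable_right fun k =>
    (continuous_schwartzZT_slice (basisFn q) k).measurable).aestronglyMeasurable, ?_⟩
  obtain rfl | h0 := eq_or_ne p 0
  · rw [eLpNorm_exponent_zero]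
    exact ENNReal.zero_lt_top
  · rw [eLpNorm_basisFn q h0]
    exact ENNReal.one_lt_top

end BasisFunctions

section Uniqueness

variable {n : ℕ} {Φ : schwartzZT n} {p : ℝ≥0∞}

theorem basisDist_mem_modZT (Φ : schwartzZT n) (hp : 1 ≤ p) (q : Zn n × Zn n) :
    basisDist q ∈ modZT Φ p := by
  classical
  have hq : distCoeff (basisDist q) = Pi.single q 1 := by
    ext q'
    rw [distCoeff_basisDist, Pi.single_apply]
    simp only [eq_comm]
  refine mem_modZT_of_eLpNorm_distCoeff_ne_top Φ hp ?_
  rw [hq, eLpNorm_single_count q 1 (zero_lt_one.trans_le hp).ne']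
  exact enorm_ne_top

/-- The distribution `basisDist q` as an element of `M^p(ℤⁿ × 𝕋ⁿ)`. -/
def basisMod (Φ : schwartzZT n) (hp : 1 ≤ p) (q : Zn n × Zn n) : modZT Φ p :=
  ⟨basisDist q, basisDist_mem_modZT Φ hp q⟩

theorem distCoeff_sub_sum_basisMod (hp : 1 ≤ p) (σ : modZT Φ p) (F : Finset (Zn n × Zn n)) :
    distCoeff (σ - ∑ q ∈ F, distCoeff σ.1 q • basisMod Φ hp q : modZT Φ p).1 =
      (F : Set (Zn n × Zn n))ᶜ.indicator (distCoeff σ.1) := by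
  ext q
  simp only [Submodule.coe_sub, Submodule.coe_sum, Submodule.coe_smul, basisMod, map_sub, map_sum,
    map_smul, Pi.sub_apply, Finset.sum_apply, Pi.smul_apply, distCoeff_basisDist, smul_eq_mul,
    mul_ite, mul_one, mul_zero, Finset.sum_ite_eq', Set.indicator_apply, Set.mem_compl_iff,
    Finset.mem_coe]
  split_ifs <;> simp_all

theorem tendsto_modNormZT_sub_sum (hΦ : Φ ≠ 0) (hp : 1 ≤ p) (hp' : p ≠ ⊤) (σ : modZT Φ p) :
    Filter.Tendsto (fun F : Finset (Zn n × Zn n) =>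
      modNormZT Φ p (σ - ∑ q ∈ F, distCoeff σ.1 q • basisMod Φ hp q : modZT Φ p).1)
      Filter.atTop (nhds 0) := by
  have hlim := ENNReal.Tendsto.const_mul
    (tendsto_eLpNorm_indicator_compl (zero_lt_one.trans_le hp).ne' hp'
      (eLpNorm_distCoeff_ne_top hΦ hp σ)) (.inr (tsum_enorm_fourierCoeffZT_ne_top Φ))
  rw [mul_zero] at hlim
  refine (ENNReal.tendsto_toReal ENNReal.zero_ne_top).comp
    (tendsto_of_tendsto_of_tendsto_of_le_of_le tendsto_const_nhds hlim (fun _ => zero_le)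
      fun F => ?_)
  rw [← distCoeff_sub_sum_basisMod hp]
  exact eLpNorm_stftZT_le Φ _ hp

theorem IsBoundedOnMod.eq_of_eq_basisMod (hΦ : Φ ≠ 0) (hp : 1 ≤ p) (hp' : p ≠ ⊤)
    {𝓛 𝓛' : modZT Φ p →ₗ[ℂ] (ell2 n →L[ℂ] ell2 n)} (h : IsBoundedOnMod 𝓛)
    (h' : IsBoundedOnMod 𝓛') (heq : ∀ q, 𝓛 (basisMod Φ hp q) = 𝓛' (basisMod Φ hp q)) :
    𝓛 = 𝓛' := by
  obtain ⟨K, hK⟩ := h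
  obtain ⟨K', hK'⟩ := h'
  ext1 σ
  have hlim := (tendsto_modNormZT_sub_sum hΦ hp hp' σ).const_mul (K + K')
  rw [mul_zero] at hlim
  suffices ‖𝓛 σ - 𝓛' σ‖ ≤ 0 from sub_eq_zero.1 (norm_le_zero_iff.1 this)
  refine ge_of_tendsto' hlim fun F => ?_
  set τ := ∑ q ∈ F, distCoeff σ.1 q • basisMod Φ hp q with hτ
  have hτ_eq : 𝓛 τ = 𝓛' τ := by simp only [hτ, map_sum, map_smul, heq]
  have hsub : 𝓛 σ - 𝓛' σ = 𝓛 (σ - τ) - 𝓛' (σ - τ) := by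
    rw [map_sub 𝓛, map_sub 𝓛', hτ_eq, sub_sub_sub_cancel_right]
  rw [hsub, add_mul]
  exact (norm_sub_le _ _).trans (add_le_add (hK _) (hK' _))

theorem ExtendsLocOp.basisMod_eq {g₁ g₂ : Zn n → ℂ} (hp : 1 ≤ p)
    {𝓛 𝓛' : modZT Φ p →ₗ[ℂ] (ell2 n →L[ℂ] ell2 n)}
    {S S' : Set (temperedZT n)} (h : ExtendsLocOp g₁ g₂ 𝓛 S) (h' : ExtendsLocOp g₁ g₂ 𝓛' S')
    {q : Zn n × Zn n} (hq : basisDist q ∈ S) (hq' : basisDist q ∈ S') :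
    𝓛 (basisMod Φ hp q) = 𝓛' (basisMod Φ hp q) := by
  ext f k
  rw [h (basisMod Φ hp q) _ hq (.inr (memLp_basisFn _ ⊤)) (isGivenBy_basisDist q),
    h' (basisMod Φ hp q) _ hq' (.inr (memLp_basisFn _ ⊤)) (isGivenBy_basisDist q)]

theorem uniqueBoundedExtension {φ : Zn n → ℂ} (hφ : IsSchwartz φ) {j : Zn n} (hj : φ j ≠ 0)
    {q₀ : Zn n × Zn n} (hq₀ : fourierCoeffZT q₀ Φ ≠ 0) (hp : 1 ≤ p) (hp' : p ≠ ⊤)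
    {g₁ g₂ : Zn n → ℂ} (hg₁ : MemMod φ 1 g₁) (hg₂ : MemMod φ 1 g₂) :
    UniqueBoundedExtension φ Φ (‖fourierCoeffZT q₀ Φ‖⁻¹ * ‖φ j‖⁻¹ * ‖φ j‖⁻¹) p g₁ g₂ := by
  have hφ0 : φ ≠ 0 := fun h => hj (congrFun h j)
  have hΦ : Φ ≠ 0 := fun h => hq₀ (by rw [h, map_zero])
  have h₁ := hg₁.summable hφ hφ0
  have h₂ := hg₂.summable hφ hφ0
  have hext := extendsLocOp_extendedLocOp (Φ := Φ) hq₀ hp h₁ h₂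
  have hle := norm_extendedLocOp_le hφ hj hq₀ hp hg₁ hg₂ h₁ h₂
  refine ⟨extendedLocOp hq₀ hp h₁ h₂, hext, hle, fun 𝓛 hbdd hext' => ?_⟩
  have hbdd' : IsBoundedOnMod (extendedLocOp (Φ := Φ) hq₀ hp h₁ h₂) :=
    ⟨‖fourierCoeffZT q₀ Φ‖⁻¹ * ‖φ j‖⁻¹ * ‖φ j‖⁻¹ * modNorm φ 1 g₁ * modNorm φ 1 g₂,
      fun σ => (hle σ).trans_eq (by ring)⟩
  exact hbdd.eq_of_eq_basisMod hΦ hp hp' hbdd' fun q => hext'.basisMod_eq hp hext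
    ⟨basisDist_mem_modZT Φ le_rfl q, basisDist_mem_modZT Φ le_top q⟩ trivial

end Uniqueness

end LocOp

end

theorem mainTheorem1_general (n : ℕ) :
    (∀ φ : LocOp.Zn n → ℂ, LocOp.IsSchwartz φ → φ ≠ 0 →
      ∀ Φ : LocOp.schwartzZT n, Φ ≠ 0 →
        ∃ C : ℝ, 0 < C ∧ ∀ p : ℝ≥0∞, 1 ≤ p → p < ⊤ →
          ∀ g₁ g₂ : LocOp.Zn n → ℂ, LocOp.MemMod φ 1 g₁ → LocOp.MemMod φ 1 g₂ →
            LocOp.UniqueBoundedExtension φ Φ C p g₁ g₂) ∧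
    (∃ (φ : LocOp.Zn n → ℂ) (Φ : LocOp.schwartzZT n),
      LocOp.IsSchwartz φ ∧
      eLpNorm φ 2 Measure.count = 1 ∧
      eLpNorm Φ.1 2 (LocOp.phaseMeasure n) = 1 ∧
      eLpNorm Φ.1 1 (LocOp.phaseMeasure n) ≤ 1 ∧
      ∀ p : ℝ≥0∞, 1 ≤ p → p < ⊤ →
        ∀ g₁ g₂ : LocOp.Zn n → ℂ, LocOp.MemMod φ 1 g₁ → LocOp.MemMod φ 1 g₂ →
          LocOp.UniqueBoundedExtension φ Φ 1 p g₁ g₂) := by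
  refine ⟨fun φ hφ hφ0 Φ hΦ => ?_, Pi.single 0 1, LocOp.basisFn 0, LocOp.isSchwartz_single 0 1,
    (LocOp.eLpNorm_single_count 0 1 two_ne_zero).trans enorm_one,
    LocOp.eLpNorm_basisFn 0 two_ne_zero, (LocOp.eLpNorm_basisFn 0 one_ne_zero).le,
    fun p hp hp' g₁ g₂ hg₁ hg₂ => ?_⟩
  · obtain ⟨j, hj : φ j ≠ 0⟩ := Function.ne_iff.1 hφ0
    obtain ⟨q₀, hq₀⟩ := LocOp.exists_fourierCoeffZT_ne_zero hΦ
    exact ⟨‖LocOp.fourierCoeffZT q₀ Φ‖⁻¹ * ‖φ j‖⁻¹ * ‖φ j‖⁻¹, by positivity,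
      fun p hp hp' g₁ g₂ => LocOp.uniqueBoundedExtension hφ hj hq₀ hp hp'.ne⟩
  · have hcoeff : LocOp.fourierCoeffZT (0 : LocOp.Zn n × LocOp.Zn n) (LocOp.basisFn 0) = 1 := by
      rw [LocOp.fourierCoeffZT_basisFn, if_pos rfl]
    have h := LocOp.uniqueBoundedExtension (LocOp.isSchwartz_single 0 1) (j := 0) (by simp)
      (hcoeff.trans_ne one_ne_zero) hp hp'.ne hg₁ hg₂
    simpa only [hcoeff, Pi.single_eq_same, norm_one, inv_one, mul_one] using h

theorem mainTheorem1 (n : ℕ) :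
    (∀ φ : LocOp.Zn n → ℂ, LocOp.IsSchwartz φ → φ ≠ 0 →
      ∀ Φ : LocOp.schwartzZT n, Φ ≠ 0 →
        ∃ C : ℝ, 0 < C ∧ ∀ p : ℝ≥0∞, 1 < p → p < ⊤ →
          ∀ g₁ g₂ : LocOp.Zn n → ℂ, LocOp.MemMod φ 1 g₁ → LocOp.MemMod φ 1 g₂ →
            LocOp.UniqueBoundedExtension φ Φ C p g₁ g₂) ∧
    (∃ (φ : LocOp.Zn n → ℂ) (Φ : LocOp.schwartzZT n),
      LocOp.IsSchwartz φ ∧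
      eLpNorm φ 2 Measure.count = 1 ∧
      eLpNorm Φ.1 2 (LocOp.phaseMeasure n) = 1 ∧
      eLpNorm Φ.1 1 (LocOp.phaseMeasure n) ≤ 1 ∧
      ∀ p : ℝ≥0∞, 1 < p → p < ⊤ →
        ∀ g₁ g₂ : LocOp.Zn n → ℂ, LocOp.MemMod φ 1 g₁ → LocOp.MemMod φ 1 g₂ →
          LocOp.UniqueBoundedExtension φ Φ 1 p g₁ g₂) := by
  obtain ⟨h, φ, Φ, hφ, hφ₂, hΦ₂, hΦ₁, h'⟩ := mainTheorem1_general n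
  exact ⟨fun φ hφ hφ0 Φ hΦ => (h φ hφ hφ0 Φ hΦ).imp fun C hC => ⟨hC.1, fun p hp => hC.2 p hp.le⟩,
    φ, Φ, hφ, hφ₂, hΦ₂, hΦ₁, fun p hp => h' p hp.le⟩
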